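/- For a positive integer $n$ let $B^n=\{z\in\mathbb C^n:\|z\|<1\}$, $B^n(a,\rho)=\{z\in\mathbb C^n:\|z-a\|<\rho\}$ and $\partial B^n_r=\{z\in\mathbb C^n:\|z\|=r\}$, let $\mathbb D$ be the unit disk in $\mathbb C$, and write $O(X,Y)$ for the set of holomorphic maps from $X$ to $Y$. For a bounded domain $D\subset\mathbb C^n$ and $z,w\in D$, let $$c_D(z,w)=\sup\{\tanh^{-1}|f(w)|:\ f\in O(D,\mathbb D),\ f(z)=0\}$$ be the Carathéodory pseudodistance, and $B^c_D(z,\rho)=\{w\in D: c_D(z,w)<\rho\}$. Define the squeezing function and the Fridman invariant (for $c$ and the model domain $B^n$) by $$s_D(z)=\sup\{\rho>0:\ B^n(0,\rho)\subset f(D)\text{ for some injective } f\in O(D,B^n)\text{ with } f(z)=0\},$$ $$\tilde e_D(z)=\sup\{\tanh\rho:\ \rho>0,\ B^c_D(z,\rho)\subset f(B^n)\text{ for some injective } f\in O(B^n,D)\}.$$ **Theorem.** Let $n\ge 1$ and $0<r<R<1$. There exists $\delta>0$ such that for every $z\in\partial B^n_r$, with $p=\frac Rr z$, $$B^n(z,\delta)\subset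 B^n\quad\text{and}\quad \tanh c_{B^n}(p,w)<R\ \text{ for all } w\in B^n(z,\delta).\qquad(*)$$ For every $\delta>0$ satisfying $(*)$ there are finitely many points $z_1,\dots,z_m\in\partial B^n_r$ with $\partial B^n_r\subset\bigcup_{i=1}^m B^n(z_i,\delta)$. For any such $\delta$ and any such points $z_i=(z_{i1},\dots,z_{in})$, put $p_i=\frac Rr z_i$, $$H_i=\Big\{w\in\mathbb C^n:\ \sum_{j=1}^n\overline{(z_{ij}-p_{ij})}\,(w_j-p_{ij})=0\Big\},\qquad D=B^n\setminus\bigcup_{i=1}^m H_i .$$ Then: 1. $D$ is a pseudoconvex domain (it is open and connected and has a continuous plurisubharmonic exhaustion function); 2. $0\in D$, $\partial B^n_r\subset D$, $s_D(0)=R$, and $s_D(w)<R$ for all $w\in\partial B^n_r$; 3. $s_D$ is not plurisubharmonic on $D$, and $\tilde e_D$ is not plurisubharmonic on $D$. -/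

import Mathlib

open Set Metric

namespace Squeezing

/-- Complex Euclidean space `ℂⁿ`. -/
abbrev Cn (n : ℕ) : Type := EuclideanSpace ℂ (Fin n)

/-- The open unit ball `Bⁿ` of `ℂⁿ`. -/
def unitBall (n : ℕ) : Set (Cn n) := ball 0 1

/-- The Carathéodory pseudodistance
`c_Ω(z, w) = sup {artanh |f w| : f ∈ O(Ω, 𝔻), f z = 0}` of a domain `Ω ⊆ ℂⁿ`
(meaningful for `z, w ∈ Ω`, where the supremum is that of a non-empty bounded set). -/
noncomputable def caratheodoryDist {n : ℕ} (Ω : Set (Cn n)) (z w : Cn n) : ℝ :=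
  sSup {t : ℝ | ∃ f : Cn n → ℂ, DifferentiableOn ℂ f Ω ∧ MapsTo f Ω (ball 0 1) ∧
    f z = 0 ∧ t = Real.artanh ‖f w‖}

/-- The ball with centre `z` and radius `ρ` in `D` for the Carathéodory pseudodistance. -/
def caratheodoryBall {n : ℕ} (D : Set (Cn n)) (z : Cn n) (ρ : ℝ) : Set (Cn n) :=
  {w | w ∈ D ∧ caratheodoryDist D z w < ρ}

/-- The squeezing function `s_D` of a bounded domain `D ⊆ ℂⁿ`: the supremum of the radii `ρ` for
which some injective holomorphic map `f : D → Bⁿ` with `f z = 0` has `ρ Bⁿ ⊆ f(D)`. -/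
noncomputable def squeezingFunction {n : ℕ} (D : Set (Cn n)) (z : Cn n) : ℝ :=
  sSup {ρ : ℝ | 0 < ρ ∧ ∃ f : Cn n → Cn n, DifferentiableOn ℂ f D ∧ MapsTo f D (unitBall n) ∧
    InjOn f D ∧ f z = 0 ∧ ball 0 ρ ⊆ f '' D}

/-- The Fridman invariant `ẽ_D` of a bounded domain `D ⊆ ℂⁿ` for the Carathéodory pseudodistance
and the model domain `Bⁿ`: the supremum of `tanh ρ` over the radii `ρ` for which the Carathéodory
ball of centre `z` and radius `ρ` lies in `f(Bⁿ)` for some injective holomorphic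
`f : Bⁿ → D`. -/
noncomputable def fridmanInvariant {n : ℕ} (D : Set (Cn n)) (z : Cn n) : ℝ :=
  sSup {t : ℝ | ∃ ρ : ℝ, 0 < ρ ∧ t = Real.tanh ρ ∧ ∃ f : Cn n → Cn n,
    DifferentiableOn ℂ f (unitBall n) ∧ MapsTo f (unitBall n) D ∧ InjOn f (unitBall n) ∧
    caratheodoryBall D z ρ ⊆ f '' unitBall n}

/-- A real-valued function `u` is plurisubharmonic on the open set `D ⊆ ℂⁿ`: it is upper
semicontinuous on `D` and satisfies the sub-mean value inequality on every closed affine complex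
disc contained in `D`. (Since `u` does not take the value `-∞`, the inequality forces the mean to be
finite; this is the integrability clause.) -/
def IsPlurisubharmonicOn {n : ℕ} (u : Cn n → ℝ) (D : Set (Cn n)) : Prop :=
  UpperSemicontinuousOn u D ∧
  ∀ a b : Cn n, (∀ ζ : ℂ, ‖ζ‖ ≤ 1 → a + ζ • b ∈ D) →
    CircleIntegrable (fun ζ : ℂ => u (a + ζ • b)) 0 1 ∧
    u a ≤ Real.circleAverage (fun ζ : ℂ => u (a + ζ • b)) 0 1

/-- `D ⊆ ℂⁿ` is a pseudoconvex domain: open, connected, non-empty, with a continuous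
plurisubharmonic exhaustion function, i.e. one whose sublevel sets are relatively compact
in `D`. -/
def IsPseudoconvexDomain {n : ℕ} (D : Set (Cn n)) : Prop :=
  IsOpen D ∧ IsConnected D ∧
  ∃ u : Cn n → ℝ, ContinuousOn u D ∧ IsPlurisubharmonicOn u D ∧
    ∀ c : ℝ, ∃ K : Set (Cn n), IsCompact K ∧ K ⊆ D ∧ {z | z ∈ D ∧ u z < c} ⊆ K

/-- The dilated point `p = (R / r) z`. -/
noncomputable def dilate {n : ℕ} (r R : ℝ) (z : Cn n) : Cn n := ((R / r : ℝ) : ℂ) • z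

/-- The condition on `δ`: for every `z ∈ ∂Bⁿ_r` and `p = (R / r) z`, one has `Bⁿ(z, δ) ⊆ Bⁿ` and
`tanh c_{Bⁿ}(p, w) < R` for all `w ∈ Bⁿ(z, δ)`. -/
def IsAdmissibleRadius (n : ℕ) (r R δ : ℝ) : Prop :=
  0 < δ ∧ ∀ z : Cn n, z ∈ sphere (0 : Cn n) r →
    ball z δ ⊆ unitBall n ∧
    ∀ w ∈ ball z δ, Real.tanh (caratheodoryDist (unitBall n) (dilate r R z) w) < R

/-- The points `z 0, …, z (m - 1)` lie on `∂Bⁿ_r`, and the balls `Bⁿ(z i, δ)` cover `∂Bⁿ_r`. -/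
def IsSphereNet {n m : ℕ} (r δ : ℝ) (z : Fin m → Cn n) : Prop :=
  (∀ i, z i ∈ sphere (0 : Cn n) r) ∧ sphere (0 : Cn n) r ⊆ ⋃ i, ball (z i) δ

/-- The complex affine hyperplane `{w : ∑ j, conj (z j - p j) * (w j - p j) = 0}` through `p`. -/
def hyperplane {n : ℕ} (z p : Cn n) : Set (Cn n) :=
  {w | ∑ j, starRingEnd ℂ (z j - p j) * (w j - p j) = 0}

/-- The domain `D = Bⁿ \ ⋃ i, H_i`, where `H_i` is the hyperplane through `p_i = (R / r) z_i`
with normal direction `z_i - p_i`. -/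
def ballMinusHyperplanes {n m : ℕ} (r R : ℝ) (z : Fin m → Cn n) : Set (Cn n) :=
  unitBall n \ ⋃ i, hyperplane (z i) (dilate r R (z i))

end Squeezing

namespace Squeezing

open Filter Topology

/-! `D` is the ball minus the zero set of `L`, a product of affine functions, and the argument works
for any entire `L`. Bounded holomorphic functions do not see the zero set, so the Schwarz lemma, and
with it the Carathéodory distance of the ball, survives on `D` (`norm_le_norm_ballInvolution`,
`caratheodoryDist_slitBall`).

Let `p` be a removed point and `φ_w` the ball involution exchanging `0` and `w`. Then both
invariants at `w` are at most `‖φ_w(p)‖`. For `s_D` (`squeezingFunction_slitBall_le`), the Schwarz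
lemma keeps `f x` in a compact part of the covered ball as `x → p`. A cluster value is some `f d`,
and openness and injectivity of `f` force `x` near `d`, not near `p`. For `ẽ_D`
(`fridmanInvariant_slitBall_le`), the inverse of `f` lives on a neighbourhood of `p` minus the zeros
of `L`. The maximum principle on discs keeps it in a compact part of the ball, so `p` would lie in
the image.

At `0` both invariants are at least `R`, since the hyperplanes miss the ball of radius `R`. On the
sphere of radius `r`, every `w` lies within `δ` of some `z_i`, so `(*)` makes both less than `R`.
The disc `ζ ↦ ζ b` with `‖b‖ = r` then violates the mean value inequality.

Holomorphy of inverses of injective maps is never needed in full. The Jacobian serves as a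
multiplier, and maximum principles of Radó type tolerate functions known to be holomorphic only off
its zeros. -/

/-! ### Maximum principles of Radó type in one variable. -/

/-- Fixed factors disappear after taking `N`-th roots. -/
theorem le_of_forall_pow_mul_le {a b m C : ℝ} (hb : 0 ≤ b) (hm : 0 < m)
    (h : ∀ N : ℕ, a ^ N * m ≤ b ^ N * C) : a ≤ b := by
  by_contra! hlt
  have ha : 0 < a := hb.trans_lt hlt
  have hlim : Tendsto (fun N : ℕ => (b / a) ^ N * C) atTop (𝓝 0) := by
    simpa using (tendsto_pow_atTop_nhds_zero_of_lt_one (by positivity)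
      ((div_lt_one ha).2 hlt)).mul_const C
  refine hm.not_ge (ge_of_tendsto' hlim fun N => ?_)
  rw [div_pow, div_mul_eq_mul_div, le_div_iff₀ (by positivity), mul_comm]
  exact h N

/-- A maximum principle for functions that are only controlled off the zero set of `h`. -/
theorem norm_le_of_frontier_off_zeros {W : Set ℂ} (hW : IsOpen W) (hWb : Bornology.IsBounded W)
    {ψ h : ℂ → ℂ} {c C : ℝ} (hc : 0 ≤ c) (hh : ContinuousOn h (closure W))
    (hhd : ∀ x ∈ W, h x ≠ 0 → DifferentiableAt ℂ h x)
    (hψb : ∀ x ∈ closure W, h x ≠ 0 → ‖ψ x‖ ≤ C)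
    (hψc : ∀ x ∈ closure W, h x ≠ 0 → ContinuousWithinAt ψ (closure W) x)
    (hψd : ∀ x ∈ W, h x ≠ 0 → DifferentiableAt ℂ ψ x)
    (hfr : ∀ x ∈ frontier W, h x ≠ 0 → ‖ψ x‖ ≤ c) {x : ℂ} (hx : x ∈ W) (hx0 : h x ≠ 0) :
    ‖ψ x‖ ≤ c := by
  obtain ⟨A, hA⟩ := hWb.isCompact_closure.exists_bound_of_continuousOn hh
  -- Apply the maximum principle to `ψ ^ N * h` where `h ≠ 0`: a frontier point of that set either
  -- is a zero of `h` or lies on the frontier of `W`.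
  have key : ∀ N : ℕ, ‖ψ x‖ ^ N * ‖h x‖ ≤ c ^ N * A := by
    intro N
    have hcont : ContinuousOn (fun y => ψ y ^ N * h y) (closure W) := by
      intro y hy
      by_cases hy0 : h y = 0
      · have h1 : Tendsto (fun y => C ^ N * ‖h y‖) (𝓝[closure W] y) (𝓝 0) := by
          have := ((hh y hy).norm.const_mul (C ^ N))
          simpa [ContinuousWithinAt, hy0] using this
        have h2 : Tendsto (fun y => ψ y ^ N * h y) (𝓝[closure W] y) (𝓝 0) := by
          refine squeeze_zero_norm' ?_ h1
          filter_upwards [self_mem_nhdsWithin] with v hv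
          by_cases hv0 : h v = 0
          · simp [hv0]
          · rw [norm_mul, norm_pow]
            gcongr
            exact hψb v hv hv0
        simpa [ContinuousWithinAt, hy0] using h2
      · exact ((hψc y hy hy0).pow N).mul (hh y hy)
    have hUo : IsOpen {y | y ∈ W ∧ h y ≠ 0} := by
      have := (hh.mono subset_closure).isOpen_inter_preimage hW (isOpen_compl_singleton (x := (0:ℂ)))
      exact this
    have hUW : closure {y | y ∈ W ∧ h y ≠ 0} ⊆ closure W := closure_mono fun y hy => hy.1
    have hd : DiffContOnCl ℂ (fun y => ψ y ^ N * h y) {y | y ∈ W ∧ h y ≠ 0} :=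
      ⟨fun y hy => (((hψd y hy.1 hy.2).pow N).mul (hhd y hy.1 hy.2)).differentiableWithinAt,
        hcont.mono hUW⟩
    have hA0 : 0 ≤ A := (norm_nonneg _).trans (hA x (subset_closure hx))
    have := Complex.norm_le_of_forall_mem_frontier_norm_le (hWb.subset fun y hy => hy.1) hd
      (C := c ^ N * A) ?_ (z := x) (subset_closure ⟨hx, hx0⟩)
    · simpa using this
    · intro y hy
      by_cases hy0 : h y = 0
      · simp only [hy0, mul_zero, norm_zero]; positivity
      · have hyc : y ∈ closure W := hUW hy.1
        have hyf : y ∈ frontier W := by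
          refine ⟨hyc, fun hyi => hy.2 ?_⟩
          rw [hUo.interior_eq]
          exact ⟨interior_subset hyi, hy0⟩
        rw [norm_mul, norm_pow]
        gcongr
        · exact hfr y hyf hy0
        · exact hA y hyc
  exact le_of_forall_pow_mul_le hc (norm_pos_iff.2 hx0) key

/-- A function on the closed disc that is holomorphic off its zeros and vanishes near a boundary
point vanishes at the centre. -/
theorem eq_zero_at_center {k : ℂ → ℂ} {η : ℝ} (hη : 0 < η) (hk : ContinuousOn k (closedBall 0 1))
    (hd : ∀ x ∈ ball (0 : ℂ) 1, k x ≠ 0 → DifferentiableAt ℂ k x)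
    (h0 : ∀ x ∈ closedBall (0 : ℂ) 1, ‖x - 1‖ < η → k x = 0) : k 0 = 0 := by
  -- Finitely many rotated copies of `k` have a product vanishing on the whole unit circle, with
  -- value a power of `k 0` at the centre.
  obtain ⟨t, ht, hcov⟩ := (isCompact_sphere (0 : ℂ) 1).elim_finite_subcover_image
    (b := sphere (0 : ℂ) 1) (c := fun a => ball a η) (fun _ _ => isOpen_ball)
    (fun x hx => mem_iUnion₂.2 ⟨x, hx, mem_ball_self hη⟩)
  obtain ⟨hfin, hcov⟩ := hcov
  set T := hfin.toFinset with hT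
  have hTn : ∀ a ∈ T, ‖(starRingEnd ℂ) a‖ = 1 := by
    intro a ha
    have := ht (hfin.mem_toFinset.1 ha)
    simpa using this
  have hmaps : ∀ a ∈ T, ∀ x ∈ closedBall (0 : ℂ) 1,
      (starRingEnd ℂ) a * x ∈ closedBall (0 : ℂ) 1 := by
    intro a ha x hx
    have := hTn a ha
    simp only [mem_closedBall, dist_zero_right] at hx ⊢
    rw [norm_mul, this, one_mul]; exact hx
  have hcont : ContinuousOn (fun x => ∏ a ∈ T, k ((starRingEnd ℂ) a * x)) (closedBall 0 1) := by
    refine continuousOn_finsetProd _ fun a ha => ?_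
    exact hk.comp (by fun_prop) (hmaps a ha)
  by_contra hne
  have hfr : ∀ x ∈ sphere (0 : ℂ) 1, ∏ a ∈ T, k ((starRingEnd ℂ) a * x) = 0 := by
    intro x hx
    obtain ⟨a, ha, hxa⟩ := mem_iUnion₂.1 (hcov hx)
    have haT : a ∈ T := hfin.mem_toFinset.2 ha
    refine Finset.prod_eq_zero haT (h0 _ (hmaps a haT x (sphere_subset_closedBall hx)) ?_)
    have h1 := hTn a haT
    have h2 : (starRingEnd ℂ) a * a = 1 := by
      rw [mul_comm, Complex.mul_conj, Complex.normSq_eq_norm_sq]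
      simp only [RCLike.norm_conj] at h1
      simp [h1]
    calc ‖(starRingEnd ℂ) a * x - 1‖ = ‖(starRingEnd ℂ) a * (x - a)‖ := by rw [mul_sub, h2]
      _ = ‖x - a‖ := by rw [norm_mul, h1, one_mul]
      _ < η := by simpa [dist_eq_norm] using hxa
  -- With `ψ = 1` and `c = 0` the bound reads `1 ≤ 0`.
  have hb := norm_le_of_frontier_off_zeros (W := ball (0 : ℂ) 1) isOpen_ball isBounded_ball
    (ψ := fun _ => 1) (h := fun x => ∏ a ∈ T, k ((starRingEnd ℂ) a * x)) (c := 0) (C := 1) le_rfl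
    (by rwa [closure_ball _ one_ne_zero]) ?_ (by simp) (fun _ _ _ => continuousWithinAt_const)
    (fun _ _ _ => differentiableAt_const _) ?_ (x := 0) (by simp) ?_
  · norm_num at hb
  · intro x hx hx0
    refine DifferentiableAt.fun_finsetProd fun a ha => ?_
    have hm : (starRingEnd ℂ) a * x ∈ ball (0 : ℂ) 1 := by
      have := hTn a ha
      simp only [mem_ball, dist_zero_right] at hx ⊢
      rw [norm_mul, this, one_mul]; exact hx
    exact (hd _ hm (Finset.prod_ne_zero_iff.1 hx0 a ha)).comp x (by fun_prop)
  · intro x hx hx0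
    rw [frontier_ball _ one_ne_zero] at hx
    exact absurd (hfr x hx) hx0
  · simpa using fun h => absurd h hne

/-! ### Identity theorem and holomorphy of derivatives. -/

section

variable {E F : Type*} [NormedAddCommGroup E] [NormedSpace ℂ E]
  [NormedAddCommGroup F] [NormedSpace ℂ F]

/-- Identity theorem for continuous functions that are holomorphic off their zeros. -/
theorem eqOn_zero_of_eqOn_open {D O : Set E} (hD : IsOpen D) (hDc : IsPreconnected D) {h : E → ℂ}
    (hh : ContinuousOn h D) (hd : ∀ x ∈ D, h x ≠ 0 → DifferentiableAt ℂ h x)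
    (hO : IsOpen O) (hOD : (D ∩ O).Nonempty) (h0 : ∀ x ∈ D ∩ O, h x = 0) :
    ∀ x ∈ D, h x = 0 := by
  set Z := interior {x | x ∈ D → h x = 0} with hZ
  have hcl : closure Z ∩ D ⊆ Z := by
    rintro x ⟨hx, hxD⟩
    obtain ⟨ρ, hρ, hρD⟩ := Metric.isOpen_iff.1 hD x hxD
    obtain ⟨o, hoZ, hox⟩ := Metric.mem_closure_iff.1 hx (ρ / 3) (by positivity)
    rw [hZ, mem_interior_iff_mem_nhds, Metric.mem_nhds_iff]
    -- For `b` this close to `x`, the disc centred at `b` with `o` on its boundary stays in the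
    -- `ρ`-ball, and `h` vanishes near `o`.
    refine ⟨ρ / 3, by positivity, fun b hb _ => ?_⟩
    have hob : dist o b < 2 * (ρ / 3) := by
      have := dist_triangle_left o b x
      rw [mem_ball, dist_comm] at hb
      linarith
    have hmem : ∀ ζ ∈ closedBall (0 : ℂ) 1, b + ζ • (o - b) ∈ D := by
      intro ζ hζ
      refine hρD ?_
      have h1 : dist (b + ζ • (o - b)) b ≤ dist o b := by
        rw [dist_eq_norm, dist_eq_norm, add_sub_cancel_left, norm_smul]
        exact mul_le_of_le_one_left (norm_nonneg _) (by simpa using hζ)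
      have := dist_triangle (b + ζ • (o - b)) b x
      rw [mem_ball] at hb ⊢
      linarith
    have hoZ' : ∀ᶠ y in 𝓝 o, y ∈ D → h y = 0 :=
      mem_interior_iff_mem_nhds.1 hoZ
    have hc : ContinuousAt (fun ζ : ℂ => b + ζ • (o - b)) 1 := by fun_prop
    have hc' : Tendsto (fun ζ : ℂ => b + ζ • (o - b)) (𝓝 1) (𝓝 o) := by
      simpa [ContinuousAt] using hc
    obtain ⟨η, hη, hη'⟩ := Metric.eventually_nhds_iff.1 (hc'.eventually hoZ')
    have := eq_zero_at_center (k := fun ζ => h (b + ζ • (o - b))) hη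
      (hh.comp (by fun_prop) hmem)
      (fun ζ hζ hne => (hd _ (hmem ζ (ball_subset_closedBall hζ)) hne).comp ζ (by fun_prop))
      (fun ζ hζ h1 => hη' (by simpa [dist_eq_norm] using h1) (hmem ζ hζ))
    simpa using this
  have hsub : D ⊆ Z := by
    refine hDc.subset_of_closure_inter_subset isOpen_interior ?_ hcl
    obtain ⟨x, hxD, hxO⟩ := hOD
    refine ⟨x, hxD, mem_interior.2 ⟨D ∩ O, fun y hy _ => h0 y hy, hD.inter hO, hxD, hxO⟩⟩
  exact fun x hx => interior_subset (hsub hx) hx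

/-- Directional derivatives of a holomorphic map are holomorphic. -/
theorem differentiableAt_fderiv_apply [FiniteDimensional ℂ E] [FiniteDimensional ℂ F] {f : E → F}
    {U : Set E} (hU : IsOpen U) (hf : DifferentiableOn ℂ f U) (v : E) {x₀ : E} (hx₀ : x₀ ∈ U) :
    DifferentiableAt ℂ (fun x => fderiv ℂ f x v) x₀ := by
  have : CompleteSpace F := FiniteDimensional.complete ℂ F
  have : ProperSpace E := FiniteDimensional.proper ℂ E
  have hfa : ∀ x ∈ U, DifferentiableAt ℂ f x := fun x hx => hf.differentiableAt (hU.mem_nhds hx)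
  -- Three nested radii: base points in `ρ`, Cauchy circles about them in `2ρ`, and balls for the
  -- derivative estimate along those circles in `3ρ`.
  obtain ⟨ρ, hρ, hρU⟩ : ∃ ρ > 0, ∀ y ∈ ball x₀ (3 * ρ), y ∈ U ∧ dist (f y) (f x₀) < 1 := by
    have h1 : ∀ᶠ y in 𝓝 x₀, y ∈ U ∧ dist (f y) (f x₀) < 1 :=
      (hU.eventually_mem hx₀).and ((hfa x₀ hx₀).continuousAt.eventually (ball_mem_nhds _ one_pos))
    obtain ⟨ρ, hρ, h⟩ := Metric.eventually_nhds_iff.1 h1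
    exact ⟨ρ / 3, by positivity, fun y hy => h (by simpa [mul_div_cancel₀] using hy)⟩
  have hcauchy : ∀ y ∈ ball x₀ (2 * ρ), ‖fderiv ℂ f y‖ ≤ 2 / ρ := by
    intro y hy
    have hsub : ball y ρ ⊆ ball x₀ (3 * ρ) := by
      refine ball_subset_ball' ?_
      rw [mem_ball] at hy; linarith
    refine Complex.norm_fderiv_le_div_of_mapsTo_ball (hf.mono fun z hz => (hρU z (hsub hz)).1) ?_ hρ
    intro z hz
    have h1 := (hρU z (hsub hz)).2
    have h2 := (hρU y (hsub (mem_ball_self hρ))).2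
    have := dist_triangle_right (f z) (f y) (f x₀)
    rw [mem_closedBall]; linarith
  set τ : ℝ := ρ / (‖v‖ + 1) with hτ
  have hτ0 : 0 < τ := by positivity
  have hτv : τ * ‖v‖ < ρ := by
    rw [hτ, div_mul_eq_mul_div, div_lt_iff₀ (by positivity)]
    nlinarith
  have hmem : ∀ x ∈ ball x₀ ρ, ∀ ζ ∈ closedBall (0 : ℂ) τ, x + ζ • v ∈ ball x₀ (2 * ρ) := by
    intro x hx ζ hζ
    have h1 : dist (x + ζ • v) x < ρ := by
      rw [dist_eq_norm, add_sub_cancel_left, norm_smul]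
      refine lt_of_le_of_lt ?_ hτv
      gcongr; simpa using hζ
    have := dist_triangle (x + ζ • v) x x₀
    rw [mem_ball] at hx ⊢; linarith
  have h23 : ball x₀ (2 * ρ) ⊆ ball x₀ (3 * ρ) := ball_subset_ball (by linarith)
  have hcm : ∀ θ, circleMap 0 τ θ ∈ closedBall (0 : ℂ) τ := fun θ =>
    sphere_subset_closedBall (circleMap_mem_sphere 0 hτ0.le θ)
  have hfm : ∀ x ∈ ball x₀ ρ, ∀ θ, x + circleMap 0 τ θ • v ∈ U := fun x hx θ =>
    (hρU _ (h23 (hmem x hx _ (hcm θ)))).1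
  set a : ℝ → ℂ := fun θ => deriv (circleMap 0 τ) θ * ((circleMap 0 τ θ) ^ 2)⁻¹ with ha
  have hane : ∀ θ, circleMap 0 τ θ ≠ 0 := fun θ => circleMap_ne_center hτ0.ne'
  have hac : Continuous a := by
    have h1 : Continuous (circleMap 0 τ) := by fun_prop
    have h2 : Continuous fun θ => deriv (circleMap 0 τ) θ := by
      simp only [deriv_circleMap]; fun_prop
    exact h2.mul ((h1.pow 2).inv₀ fun θ => pow_ne_zero 2 (hane θ))
  -- Cauchy's formula along the line in direction `v`; differentiation under the integral then needs
  -- only first derivatives of `f`.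
  have hrep : ∀ x ∈ ball x₀ ρ, fderiv ℂ f x v = (2 * Real.pi * Complex.I : ℂ)⁻¹ •
      ∫ θ in (0 : ℝ)..2 * Real.pi, a θ • f (x + circleMap 0 τ θ • v) := by
    intro x hx
    have hxU : x ∈ U := (hρU x (ball_subset_ball (by linarith) hx)).1
    set V : Set ℂ := {ζ | x + ζ • v ∈ U} with hV
    have hVo : IsOpen V := hU.preimage (by fun_prop)
    have hd : DifferentiableOn ℂ (fun ζ : ℂ => f (x + ζ • v)) V := fun ζ hζ =>
      ((hfa _ hζ).comp ζ (f := fun ζ : ℂ => x + ζ • v) (by fun_prop)).differentiableWithinAt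
    have h1 := Complex.two_pi_I_inv_smul_circleIntegral_sub_sq_inv_smul_of_differentiable hVo
      (c := 0) (R := τ) (w₀ := 0)
      (fun ζ hζ => (hρU _ (h23 (hmem x hx ζ hζ))).1) hd (mem_ball_self hτ0)
    have h2 : deriv (fun ζ : ℂ => f (x + ζ • v)) 0 = fderiv ℂ f x v := by
      have h3 : HasDerivAt (fun ζ : ℂ => x + ζ • v) v 0 := by
        simpa using ((hasDerivAt_id (0 : ℂ)).smul_const v).const_add x
      have h4 : HasFDerivAt f (fderiv ℂ f x) (x + (0 : ℂ) • v) := by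
        simpa using (hfa x hxU).hasFDerivAt
      exact (h4.comp_hasDerivAt (0 : ℂ) h3).deriv
    rw [← h2, ← h1]
    simp only [circleIntegral, sub_zero, ha, smul_smul]
  have hae : ∀ᶠ x in 𝓝 x₀, fderiv ℂ f x v = (2 * Real.pi * Complex.I : ℂ)⁻¹ •
      ∫ θ in (0 : ℝ)..2 * Real.pi, a θ • f (x + circleMap 0 τ θ • v) :=
    eventually_of_mem (ball_mem_nhds x₀ hρ) hrep
  refine DifferentiableAt.congr_of_eventuallyEq ?_ hae
  refine DifferentiableAt.const_smul ?_ _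
  have hcont : ∀ x ∈ ball x₀ ρ, Continuous fun θ => a θ • f (x + circleMap 0 τ θ • v) := by
    intro x hx
    refine hac.smul (hf.continuousOn.comp_continuous (by fun_prop) (hfm x hx))
  borelize E
  borelize (E →L[ℂ] F)
  have := FiniteDimensional.proper ℂ (E →L[ℂ] F)
  refine (intervalIntegral.hasFDerivAt_integral_of_dominated_of_fderiv_le
    (F := fun x θ => a θ • f (x + circleMap 0 τ θ • v))
    (F' := fun x θ => a θ • fderiv ℂ f (x + circleMap 0 τ θ • v))
    (bound := fun θ => ‖a θ‖ * (2 / ρ)) (ball_mem_nhds x₀ hρ)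
    (eventually_of_mem (ball_mem_nhds x₀ hρ) fun x hx => (hcont x hx).aestronglyMeasurable)
    ((hcont x₀ (mem_ball_self hρ)).intervalIntegrable _ _) ?_ ?_
    ((hac.norm.mul_const _).intervalIntegrable _ _) ?_).differentiableAt
  · refine hac.aestronglyMeasurable.smul (Measurable.aestronglyMeasurable ?_)
    exact (measurable_fderiv ℂ f).comp (by fun_prop)
  · refine .of_forall fun θ _ x hx => ?_
    rw [norm_smul]
    gcongr
    exact hcauchy _ (hmem x hx _ (hcm θ))
  · refine .of_forall fun θ _ x hx => ?_
    have h1 := (hfa _ (hfm x hx θ)).hasFDerivAt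
    exact (h1.comp x ((hasFDerivAt_id x).add_const _)).const_smul (a θ)

end

/-! ### The Jacobian and openness of injective holomorphic maps. -/

section

variable {E : Type*} [NormedAddCommGroup E] [NormedSpace ℂ E]

theorem differentiableAt_finsetProd {ι : Type*} {s : Finset ι} {g : ι → E → ℂ} {x : E}
    (hg : ∀ i ∈ s, DifferentiableAt ℂ (g i) x) :
    DifferentiableAt ℂ (fun y => ∏ i ∈ s, g i y) x := by
  classical
  induction s using Finset.induction_on with
  | empty => simp
  | insert a s ha ih =>
    simp only [Finset.prod_insert ha]
    exact (hg a (Finset.mem_insert_self a s)).mul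
      (ih fun i hi => hg i (Finset.mem_insert_of_mem hi))

/-- The complex Jacobian determinant. -/
noncomputable def jacobian (f : E → E) (x : E) : ℂ := (fderiv ℂ f x).det

variable [FiniteDimensional ℂ E] {f : E → E} {D : Set E}

theorem continuousOn_fderiv_of_differentiableOn (hD : IsOpen D) (hf : DifferentiableOn ℂ f D) :
    ContinuousOn (fderiv ℂ f) D := by
  rw [← contDiffOn_zero (𝕜 := ℂ), contDiffOn_clm_apply]
  intro v
  rw [contDiffOn_zero]
  exact fun x hx => (differentiableAt_fderiv_apply hD hf v hx).continuousAt.continuousWithinAt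

theorem differentiableAt_jacobian (hD : IsOpen D) (hf : DifferentiableOn ℂ f D) {x : E}
    (hx : x ∈ D) : DifferentiableAt ℂ (jacobian f) x := by
  set b := Module.finBasis ℂ E
  have h : jacobian f = fun x => ∑ σ : Equiv.Perm (Fin (Module.finrank ℂ E)),
      ((Equiv.Perm.sign σ : ℤ) : ℂ) * ∏ i, b.coord (σ i) (fderiv ℂ f x (b i)) := by
    funext x
    rw [jacobian, ContinuousLinearMap.det, ← LinearMap.det_toMatrix b, Matrix.det_apply']
    simp [LinearMap.toMatrix_apply]
  rw [h]
  refine DifferentiableAt.fun_sum fun σ _ => DifferentiableAt.const_mul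
    (differentiableAt_finsetProd fun i _ => ?_) _
  exact (LinearMap.toContinuousLinearMap (b.coord (σ i))).differentiableAt.comp x
    (differentiableAt_fderiv_apply hD hf (b i) hx)

/-- A Jacobian vanishing on an open piece of `D` vanishes on `D`, and Sard's lemma makes the image a
null set. -/
theorem exists_jacobian_ne_zero (hD : IsOpen D) (hDc : IsPreconnected D)
    (hf : DifferentiableOn ℂ f D) (hint : (interior (f '' D)).Nonempty) {O : Set E}
    (hO : IsOpen O) (hOD : (D ∩ O).Nonempty) : ∃ x ∈ D ∩ O, jacobian f x ≠ 0 := by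
  by_contra! hcon
  have hzero := eqOn_zero_of_eqOn_open hD hDc
    (fun x hx => (differentiableAt_jacobian hD hf hx).continuousAt.continuousWithinAt)
    (fun x hx _ => differentiableAt_jacobian hD hf hx) hO hOD hcon
  borelize E
  have hdet : ∀ x ∈ D, ((fderiv ℂ f x).restrictScalars ℝ).det = 0 := by
    intro x hx
    have h1 : LinearMap.det ((fderiv ℂ f x : E →L[ℂ] E) : E →ₗ[ℂ] E) = 0 := hzero x hx
    have h2 := LinearMap.det_restrictScalars (R := ℝ)
      (f := ((fderiv ℂ f x : E →L[ℂ] E) : E →ₗ[ℂ] E))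
    rw [h1, Algebra.norm_zero] at h2
    exact h2
  have := MeasureTheory.addHaar_image_eq_zero_of_det_fderivWithin_eq_zero
    (MeasureTheory.Measure.addHaar (G := E)) (s := D) (f := f)
    (fun x hx => ((hf.differentiableAt
      (hD.mem_nhds hx)).hasFDerivAt.restrictScalars ℝ).hasFDerivWithinAt) hdet
  exact (isOpen_interior.measure_pos _ hint).ne'
    (MeasureTheory.measure_mono_null interior_subset this)

theorem map_nhds_eq_of_jacobian_ne_zero (hD : IsOpen D) (hf : DifferentiableOn ℂ f D) {x : E}
    (hx : x ∈ D) (hj : jacobian f x ≠ 0) : map f (𝓝 x) = 𝓝 (f x) := by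
  have : CompleteSpace E := FiniteDimensional.complete ℂ E
  have h1 : HasStrictFDerivAt f (fderiv ℂ f x) x := by
    refine hasStrictFDerivAt_of_hasFDerivAt_of_continuousAt ?_
      ((continuousOn_fderiv_of_differentiableOn hD hf).continuousAt (hD.mem_nhds hx))
    filter_upwards [hD.mem_nhds hx] with y hy
    exact (hf.differentiableAt (hD.mem_nhds hy)).hasFDerivAt
  rw [← ContinuousLinearMap.coe_toContinuousLinearEquivOfDetNeZero (fderiv ℂ f x) hj] at h1
  exact h1.map_nhds_eq_of_equiv

theorem differentiableAt_of_local_left_inverse (hD : IsOpen D) (hf : DifferentiableOn ℂ f D)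
    {g : E → E} {y : E} (hy : g y ∈ D) (hj : jacobian f (g y) ≠ 0) (hg : ContinuousAt g y)
    (hfg : ∀ᶠ z in 𝓝 y, f (g z) = z) : DifferentiableAt ℂ g y := by
  have h1 := (hf.differentiableAt (hD.mem_nhds hy)).hasFDerivAt
  rw [← ContinuousLinearMap.coe_toContinuousLinearEquivOfDetNeZero (fderiv ℂ f (g y)) hj] at h1
  exact (HasFDerivAt.of_local_left_inverse hg h1 hfg).differentiableAt

theorem continuousOn_invFunOn_image {X Y : Type*} [TopologicalSpace X] [TopologicalSpace Y]
    [T2Space Y] [Nonempty X] {f : X → Y} {K : Set X} (hK : IsCompact K) (hf : ContinuousOn f K)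
    (hinj : InjOn f K) : ContinuousOn (Function.invFunOn f K) (f '' K) := by
  rw [continuousOn_iff_isClosed]
  intro C hC
  refine ⟨f '' (C ∩ K), ((hK.inter_left hC).image_of_continuousOn
    (hf.mono inter_subset_right)).isClosed, ?_⟩
  ext y
  constructor
  · rintro ⟨hy, x, hx, rfl⟩
    refine ⟨⟨x, ⟨?_, hx⟩, rfl⟩, x, hx, rfl⟩
    have := hinj.leftInvOn_invFunOn hx
    rwa [mem_preimage, this] at hy
  · rintro ⟨⟨x, ⟨hxC, hx⟩, rfl⟩, -⟩
    refine ⟨?_, x, hx, rfl⟩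
    rw [mem_preimage, hinj.leftInvOn_invFunOn hx]
    exact hxC

/-- An injective holomorphic map whose image has interior points is open. -/
theorem image_mem_nhds_of_injOn (hD : IsOpen D) (hDc : IsPreconnected D)
    (hf : DifferentiableOn ℂ f D) (hinj : InjOn f D) (hint : (interior (f '' D)).Nonempty)
    {d : E} (hd : d ∈ D) {N : Set E} (hN : N ∈ 𝓝 d) : f '' N ∈ 𝓝 (f d) := by
  have : ProperSpace E := FiniteDimensional.proper ℂ E
  obtain ⟨s, hs, hsN⟩ := Metric.nhds_basis_closedBall.mem_iff.1 (inter_mem hN (hD.mem_nhds hd))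
  set K := closedBall d s with hKdef
  have hKD : K ⊆ D := fun x hx => (hsN hx).2
  have hK : IsCompact K := isCompact_closedBall d s
  have hcK := hf.continuousOn.mono hKD
  have hinjK := hinj.mono hKD
  have hfK : IsClosed (f '' K) := (hK.image_of_continuousOn hcK).isClosed
  have hS : IsClosed (f '' sphere d s) := ((isCompact_sphere d s).image_of_continuousOn
    (hcK.mono sphere_subset_closedBall)).isClosed
  have hdS : f d ∉ f '' sphere d s := by
    rintro ⟨x, hx, hxd⟩
    have := hinj (hKD (sphere_subset_closedBall hx)) hd hxd
    subst this
    simp [hs.ne] at hx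
  obtain ⟨ε, hε, hεS⟩ := Metric.isOpen_iff.1 hS.isOpen_compl _ hdS
  set g := Function.invFunOn f K with hg
  have hgf : ∀ x ∈ K, g (f x) = x := fun x hx => hinjK.leftInvOn_invFunOn hx
  have hgc : ContinuousOn g (f '' K) := continuousOn_invFunOn_image hK hcK hinjK
  -- The Jacobian transported to the image and extended by zero. Where it is nonzero the inverse is
  -- holomorphic, so `h` is holomorphic off its zeros.
  set h : E → ℂ := (f '' K).indicator (jacobian f ∘ g) with hh
  have hhK : ∀ x ∈ K, h (f x) = jacobian f x := by
    intro x hx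
    rw [hh, indicator_of_mem (mem_image_of_mem f hx), Function.comp, hgf x hx]
  have hdiff : ∀ y ∈ ball (f d) ε, h y ≠ 0 → DifferentiableAt ℂ h y := by
    intro y hy hy0
    obtain ⟨x, hx, rfl⟩ := mem_of_indicator_ne_zero hy0
    rw [hhK x hx] at hy0
    have hxb : x ∈ ball d s := by
      refine lt_of_le_of_ne (mem_closedBall.1 hx) fun hxs => hεS hy ⟨x, hxs, rfl⟩
    have hnhds : f '' K ∈ 𝓝 (f x) := by
      rw [← map_nhds_eq_of_jacobian_ne_zero hD hf (hKD hx) hy0]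
      exact image_mem_map (mem_of_superset (isOpen_ball.mem_nhds hxb) ball_subset_closedBall)
    have hgx : DifferentiableAt ℂ g (f x) := by
      refine differentiableAt_of_local_left_inverse hD hf (by rw [hgf x hx]; exact hKD hx)
        (by rwa [hgf x hx]) (hgc.continuousAt hnhds) ?_
      filter_upwards [hnhds] with z hz
      exact Function.invFunOn_eq hz
    have hj : DifferentiableAt ℂ (jacobian f) (g (f x)) := by
      rw [hgf x hx]; exact differentiableAt_jacobian hD hf (hKD hx)
    refine (hj.comp (f x) hgx).congr_of_eventuallyEq ?_
    filter_upwards [hnhds] with z hz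
    rw [hh, indicator_of_mem hz]
  have hcont : ContinuousOn h (ball (f d) ε) := by
    intro y hy
    by_cases hy0 : h y = 0
    · refine ContinuousAt.continuousWithinAt ?_
      rw [ContinuousAt, hy0]
      by_cases hyK : y ∈ f '' K
      · have h1 : Tendsto (jacobian f ∘ g) (𝓝[f '' K] y) (𝓝 0) := by
          obtain ⟨x, hx, rfl⟩ := hyK
          have h2 : ContinuousAt (jacobian f) (g (f x)) := by
            rw [hgf x hx]; exact (differentiableAt_jacobian hD hf (hKD hx)).continuousAt
          have h3 := h2.comp_continuousWithinAt (hgc (f x) ⟨x, hx, rfl⟩)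
          rw [ContinuousWithinAt] at h3
          rw [hhK x hx] at hy0
          simpa [hgf x hx, hy0] using h3
        rw [hh]
        rw [_root_.tendsto_nhds] at h1 ⊢
        intro s hs h0s
        have h2 := mem_nhdsWithin_iff_eventually.1 (h1 s hs h0s)
        filter_upwards [h2] with z hz
        by_cases hzK : z ∈ f '' K
        · rw [mem_preimage, indicator_of_mem hzK]; exact hz hzK
        · rw [mem_preimage, indicator_of_notMem hzK]; exact h0s
      · refine tendsto_const_nhds.congr' ?_
        filter_upwards [hfK.isOpen_compl.mem_nhds hyK] with z hz
        rw [hh, indicator_of_notMem hz]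
    · exact (hdiff y hy hy0).continuousAt.continuousWithinAt
  have hsub : ball (f d) ε ⊆ f '' K := by
    by_contra hns
    obtain ⟨y, hyB, hyK⟩ := not_subset.1 hns
    -- A missed point gives an open set on which `h = 0`, so `h` vanishes on the whole ball and the
    -- Jacobian vanishes near `d`.
    have hz := eqOn_zero_of_eqOn_open isOpen_ball
      (convex_ball (f d) ε).isPreconnected hcont hdiff
      hfK.isOpen_compl ⟨y, hyB, hyK⟩ fun z hz => by rw [hh, indicator_of_notMem hz.2]
    have hev : ∀ᶠ x in 𝓝 d, x ∈ K ∧ f x ∈ ball (f d) ε := by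
      refine Filter.Eventually.and (closedBall_mem_nhds d hs) ?_
      exact (hf.differentiableAt (hD.mem_nhds hd)).continuousAt.eventually
        (ball_mem_nhds _ hε)
    obtain ⟨O, hO, hOo, hdO⟩ := _root_.eventually_nhds_iff.1 hev
    obtain ⟨x, hx, hxj⟩ := exists_jacobian_ne_zero hD hDc hf hint hOo ⟨d, hd, hdO⟩
    obtain ⟨hxK, hxb⟩ := hO x hx.2
    exact hxj (by rw [← hhK x hxK]; exact hz _ hxb)
  exact mem_of_superset (ball_mem_nhds _ hε)
    (hsub.trans (image_mono fun x hx => (hsN hx).1))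

/-- The inverse of an injective open holomorphic map is continuous. -/
theorem continuousAt_invFunOn_of_injOn (hD : IsOpen D) (hDc : IsPreconnected D)
    (hf : DifferentiableOn ℂ f D) (hinj : InjOn f D) (hint : (interior (f '' D)).Nonempty)
    {d : E} (hd : d ∈ D) : ContinuousAt (Function.invFunOn f D) (f d) := by
  have hgf : ∀ x ∈ D, Function.invFunOn f D (f x) = x := fun x hx => hinj.leftInvOn_invFunOn hx
  rw [ContinuousAt, hgf d hd]
  intro N hN
  have := image_mem_nhds_of_injOn hD hDc hf hinj hint hd (inter_mem hN (hD.mem_nhds hd))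
  refine Filter.mem_map.2 (mem_of_superset this ?_)
  rintro _ ⟨x, hx, rfl⟩
  rw [mem_preimage, hgf x hx.2]
  exact hx.1

end

/-! ### Ball involutions, the Schwarz lemma and the Carathéodory distance. -/

section

variable {n : ℕ}

/-- The involutive automorphism of the unit ball interchanging `0` and `w`. -/
noncomputable def ballInvolution (w z : Cn n) : Cn n :=
  (1 - inner ℂ w z)⁻¹ •
    ((1 - inner ℂ w z / (1 + (√(1 - ‖w‖ ^ 2) : ℝ))) • w - ((√(1 - ‖w‖ ^ 2) : ℝ) : ℂ) • z)

theorem one_sub_inner_ne_zero {w z : Cn n} (hw : ‖w‖ < 1) (hz : ‖z‖ < 1) :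
    (1 : ℂ) - inner ℂ w z ≠ 0 := by
  intro h
  have h1 : ‖(inner ℂ w z : ℂ)‖ = 1 := by rw [← sub_eq_zero.1 h]; simp
  have h2 := norm_inner_le_norm (𝕜 := ℂ) w z
  nlinarith [norm_nonneg w, norm_nonneg z]

/-- This identity yields invariance of the ball, symmetry of `‖φ_w(z)‖` and the choice of `δ`. -/
theorem one_sub_norm_ballInvolution_sq {w z : Cn n} (hw : ‖w‖ < 1) (hz : ‖z‖ < 1) :
    (1 - ‖ballInvolution w z‖ ^ 2) * ‖(1 : ℂ) - inner ℂ w z‖ ^ 2 =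
      (1 - ‖w‖ ^ 2) * (1 - ‖z‖ ^ 2) := by
  have hne := one_sub_inner_ne_zero hw hz
  have hs2 : √(1 - ‖w‖ ^ 2) ^ 2 = 1 - ‖w‖ ^ 2 := Real.sq_sqrt (by nlinarith [norm_nonneg w])
  have hs0 := Real.sqrt_nonneg (1 - ‖w‖ ^ 2)
  rw [ballInvolution]
  set s := √(1 - ‖w‖ ^ 2)
  set t : ℂ := inner ℂ w z with ht
  have h1s : (1 + s) ≠ 0 := by positivity
  have hα : (1 : ℂ) - t / (1 + (s : ℂ)) = ⟨1 - t.re / (1 + s), - (t.im / (1 + s))⟩ := by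
    have : (1 : ℂ) + (s : ℂ) = ((1 + s : ℝ) : ℂ) := by push_cast; rfl
    rw [this]
    apply Complex.ext
    · rw [Complex.sub_re, Complex.div_ofReal_re]; rfl
    · rw [Complex.sub_im, Complex.div_ofReal_im]; simp
  rw [norm_smul, norm_inv, mul_pow, sub_mul, inv_pow, mul_right_comm,
    inv_mul_cancel₀ (pow_ne_zero 2 (norm_ne_zero_iff.2 hne)), one_mul, one_mul,
    norm_sub_sq (𝕜 := ℂ) (_ • w) (_ • z), inner_smul_left, inner_smul_right, norm_smul, norm_smul, hα, ← ht,
    mul_pow, mul_pow, Complex.norm_real, Real.norm_of_nonneg hs0, hs2, ← Complex.normSq_eq_norm_sq,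
    ← Complex.normSq_eq_norm_sq]
  simp only [Complex.normSq_apply, Complex.sub_re, Complex.sub_im, Complex.one_re, Complex.one_im,
    RCLike.re_to_complex, Complex.mul_re, Complex.mul_im, Complex.conj_re, Complex.conj_im,
    Complex.ofReal_re, Complex.ofReal_im]
  have hw2 : ‖w‖ ^ 2 = 1 - s ^ 2 := by linarith
  rw [hw2]
  field_simp
  ring

theorem norm_ballInvolution_lt_one {w z : Cn n} (hw : ‖w‖ < 1) (hz : ‖z‖ < 1) :
    ‖ballInvolution w z‖ < 1 := by
  have h := one_sub_norm_ballInvolution_sq hw hz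
  have h1 : 0 < (1 - ‖w‖ ^ 2) * (1 - ‖z‖ ^ 2) :=
    mul_pos (by nlinarith [norm_nonneg w]) (by nlinarith [norm_nonneg z])
  rw [← h] at h1
  have h2 := pos_of_mul_pos_left h1 (by positivity)
  nlinarith [norm_nonneg (ballInvolution w z)]

/-- Needed because `(*)` measures from `p`, whereas the bounds on the invariants measure from `w`.
-/
theorem norm_ballInvolution_comm {w z : Cn n} (hw : ‖w‖ < 1) (hz : ‖z‖ < 1) :
    ‖ballInvolution w z‖ = ‖ballInvolution z w‖ := by
  have h1 := one_sub_norm_ballInvolution_sq hw hz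
  have h2 := one_sub_norm_ballInvolution_sq hz hw
  have h3 : ‖(1 : ℂ) - inner ℂ z w‖ = ‖(1 : ℂ) - inner ℂ w z‖ := by
    rw [← inner_conj_symm w z, ← RCLike.norm_conj (1 - (starRingEnd ℂ) _)]
    simp
  rw [h3, mul_comm (1 - ‖z‖ ^ 2), ← h1] at h2
  have h4 := mul_right_cancel₀
    (pow_ne_zero 2 (norm_ne_zero_iff.2 (one_sub_inner_ne_zero hw hz))) h2
  exact (pow_left_inj₀ (norm_nonneg _) (norm_nonneg _) two_ne_zero).1 (by linarith)

@[simp] theorem ballInvolution_zero_right (w : Cn n) : ballInvolution w 0 = w := by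
  simp [ballInvolution]

theorem norm_ballInvolution_zero_left (z : Cn n) : ‖ballInvolution 0 z‖ = ‖z‖ := by
  simp [ballInvolution]

theorem ballInvolution_ballInvolution {w z : Cn n} (hw : ‖w‖ < 1) (hz : ‖z‖ < 1) :
    ballInvolution w (ballInvolution w z) = z := by
  have hne := one_sub_inner_ne_zero hw hz
  have hs2 : √(1 - ‖w‖ ^ 2) ^ 2 = 1 - ‖w‖ ^ 2 := Real.sq_sqrt (by nlinarith [norm_nonneg w])
  have hs0 : 0 < √(1 - ‖w‖ ^ 2) := Real.sqrt_pos.2 (by nlinarith [norm_nonneg w])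
  have hi : inner ℂ w (ballInvolution w z) =
      (1 - inner ℂ w z)⁻¹ * (1 - ((√(1 - ‖w‖ ^ 2) : ℝ) : ℂ) ^ 2 - inner ℂ w z) := by
    rw [ballInvolution, inner_smul_right, inner_sub_right, inner_smul_right, inner_smul_right,
      inner_self_eq_norm_sq_to_K]
    have hw2' : ((‖w‖ : ℝ) : ℂ) ^ 2 = 1 - ((√(1 - ‖w‖ ^ 2) : ℝ) : ℂ) ^ 2 := by
      rw [← Complex.ofReal_pow, ← Complex.ofReal_pow, hs2]; push_cast; ring
    have h1s : (1 : ℂ) + ((√(1 - ‖w‖ ^ 2) : ℝ) : ℂ) ≠ 0 := by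
      rw [← Complex.ofReal_one, ← Complex.ofReal_add, Complex.ofReal_ne_zero]; positivity
    simp only [Complex.coe_algebraMap]
    rw [hw2']
    generalize ((√(1 - ‖w‖ ^ 2) : ℝ) : ℂ) = s at *
    field_simp
    ring
  rw [ballInvolution, hi, ballInvolution]
  have h1s : (1 : ℂ) + ((√(1 - ‖w‖ ^ 2) : ℝ) : ℂ) ≠ 0 := by
    rw [← Complex.ofReal_one, ← Complex.ofReal_add, Complex.ofReal_ne_zero]; positivity
  have hs : ((√(1 - ‖w‖ ^ 2) : ℝ) : ℂ) ≠ 0 := Complex.ofReal_ne_zero.2 hs0.ne'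
  generalize ((√(1 - ‖w‖ ^ 2) : ℝ) : ℂ) = s at *
  generalize (inner ℂ w z : ℂ) = t at *
  have h1 : 1 - (1 - t)⁻¹ * (1 - s ^ 2 - t) = s ^ 2 / (1 - t) := by
    field_simp
    ring
  rw [h1]
  match_scalars <;> field_simp
  ring

theorem ballInvolution_self {w : Cn n} (hw : ‖w‖ < 1) : ballInvolution w w = 0 := by
  simpa using ballInvolution_ballInvolution hw (z := 0) (by simp)

theorem differentiableAt_ballInvolution {w z : Cn n} (hw : ‖w‖ < 1) (hz : ‖z‖ < 1) :
    DifferentiableAt ℂ (ballInvolution w) z := by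
  have hi : DifferentiableAt ℂ (fun z : Cn n => (inner ℂ w z : ℂ)) z :=
    (innerSL ℂ w).differentiableAt
  unfold ballInvolution
  simp only [div_eq_mul_inv]
  refine (((differentiableAt_const _).sub hi).inv (one_sub_inner_ne_zero hw hz)).smul ?_
  exact ((((differentiableAt_const _).sub (hi.mul_const _))).smul_const w).sub
    (differentiableAt_fun_id.fun_const_smul _)

/-- The unit ball with the zero set of `L` removed. -/
def slitBall (L : Cn n → ℂ) : Set (Cn n) := {z | ‖z‖ < 1 ∧ L z ≠ 0}

theorem isOpen_slitBall {L : Cn n → ℂ} (hL : Differentiable ℂ L) : IsOpen (slitBall L) :=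
  (isOpen_lt continuous_norm continuous_const).inter
    (isOpen_compl_singleton.preimage hL.continuous)

/-- The Schwarz lemma on the slit ball. -/
theorem norm_le_norm_ballInvolution {L : Cn n → ℂ} (hL : Differentiable ℂ L) {k : Cn n → ℂ}
    (hk : DifferentiableOn ℂ k (slitBall L)) (hk1 : ∀ z ∈ slitBall L, ‖k z‖ ≤ 1) {w x : Cn n}
    (hw : w ∈ slitBall L) (hx : x ∈ slitBall L) (hkw : k w = 0) :
    ‖k x‖ ≤ ‖ballInvolution w x‖ := by
  have hD := isOpen_slitBall hL
  set y := ballInvolution w x with hy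
  have hy1 : ‖y‖ < 1 := norm_ballInvolution_lt_one hw.1 hx.1
  have hyx : ballInvolution w y = x := ballInvolution_ballInvolution hw.1 hx.1
  by_cases hy0 : y = 0
  · rw [hy0, ballInvolution_zero_right] at hyx
    rw [← hyx, hkw]; simp
  have hyn : 0 < ‖y‖ := norm_pos_iff.2 hy0
  set u : Cn n := ((‖y‖ : ℂ)⁻¹) • y with hu
  have hu1 : ‖u‖ = 1 := by rw [hu, norm_smul, norm_inv, Complex.norm_real, norm_norm]; field_simp
  have huy : ((‖y‖ : ℝ) : ℂ) • u = y := by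
    rw [hu, smul_smul, mul_inv_cancel₀ (Complex.ofReal_ne_zero.2 hyn.ne'), one_smul]
  set γ : ℂ → Cn n := fun ζ => ballInvolution w (ζ • u) with hγ
  have hζu : ∀ ζ : ℂ, ‖ζ • u‖ = ‖ζ‖ := fun ζ => by rw [norm_smul, hu1, mul_one]
  have hγ1 : ∀ ζ : ℂ, ‖ζ‖ < 1 → ‖γ ζ‖ < 1 := fun ζ hζ =>
    norm_ballInvolution_lt_one hw.1 (by rwa [hζu])
  have hγd : ∀ ζ : ℂ, ‖ζ‖ < 1 → DifferentiableAt ℂ γ ζ := fun ζ hζ =>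
    (differentiableAt_ballInvolution hw.1 (by rwa [hζu])).comp ζ
      (f := fun ζ : ℂ => ζ • u) (by fun_prop)
  have hγ0 : γ 0 = w := by simp [hγ]
  have hkd : ∀ ζ : ℂ, ‖ζ‖ < 1 → L (γ ζ) ≠ 0 → DifferentiableAt ℂ (fun ζ => k (γ ζ)) ζ :=
    fun ζ hζ h => (hk.differentiableAt (hD.mem_nhds ⟨hγ1 ζ hζ, h⟩)).comp ζ (hγd ζ hζ)
  -- Near `0` the quotient is bounded because `k ∘ γ` is differentiable with value `0` there;
  -- elsewhere by `1 / δ`.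
  obtain ⟨C, hC⟩ : ∃ C, ∀ ζ : ℂ, ‖ζ‖ < 1 → ζ * L (γ ζ) ≠ 0 → ‖k (γ ζ) / ζ‖ ≤ C := by
    have h1 := (hkd 0 (by simp) (by rw [hγ0]; exact hw.2)).isBigO_sub
    simp only [hγ0, hkw, sub_zero] at h1
    obtain ⟨A, hA⟩ := h1.bound
    obtain ⟨δ, hδ, hA⟩ := Metric.eventually_nhds_iff.1 hA
    refine ⟨max A (1 / δ), fun ζ hζ hne => ?_⟩
    have hζ0 : 0 < ‖ζ‖ := norm_pos_iff.2 (left_ne_zero_of_mul hne)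
    rw [norm_div]
    by_cases hζδ : ‖ζ‖ < δ
    · refine le_max_of_le_left ((div_le_iff₀ hζ0).2 ?_)
      exact hA (by simpa using hζδ)
    · refine le_max_of_le_right ?_
      rw [not_lt] at hζδ
      have := hk1 _ ⟨hγ1 ζ hζ, right_ne_zero_of_mul hne⟩
      gcongr
  by_contra! hlt
  -- On the circle of radius `t` the quotient is at most `1 / t`, which is less than its value at
  -- `‖y‖` if the claim fails.
  obtain ⟨t, ht, ht1⟩ := exists_between ((div_lt_one (hyn.trans hlt)).2 hlt)
  have hk0 : 0 < ‖k x‖ := hyn.trans hlt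
  have hyt : ‖y‖ < t := by
    refine lt_of_le_of_lt ?_ ht
    rw [le_div_iff₀ hk0]
    exact mul_le_of_le_one_right hyn.le (hk1 x hx)
  have ht0 : 0 < t := hyn.trans hyt
  have hcl : ∀ ζ ∈ closure (ball (0 : ℂ) t), ‖ζ‖ < 1 := by
    intro ζ hζ
    rw [closure_ball _ ht0.ne'] at hζ
    exact (by simpa using hζ : ‖ζ‖ ≤ t).trans_lt ht1
  have hψd : ∀ ζ ∈ closure (ball (0 : ℂ) t), ζ * L (γ ζ) ≠ 0 →
      DifferentiableAt ℂ (fun ζ => k (γ ζ) / ζ) ζ := fun ζ hζ hne =>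
    (hkd ζ (hcl ζ hζ) (right_ne_zero_of_mul hne)).div differentiableAt_id
      (left_ne_zero_of_mul hne)
  have hhd : ∀ ζ ∈ closure (ball (0 : ℂ) t), DifferentiableAt ℂ (fun ζ => ζ * L (γ ζ)) ζ :=
    fun ζ hζ => differentiableAt_id.mul ((hL _).comp ζ (hγd ζ (hcl ζ hζ)))
  have hγy : γ (‖y‖ : ℝ) = x := by
    change ballInvolution w (((‖y‖ : ℝ) : ℂ) • u) = x
    rw [huy, hyx]
  -- The multiplier `ζ * L (γ ζ)` removes both the slit and the origin, where the quotient is not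
  -- controlled.
  have := norm_le_of_frontier_off_zeros (W := ball (0 : ℂ) t) isOpen_ball isBounded_ball
    (ψ := fun ζ => k (γ ζ) / ζ) (h := fun ζ => ζ * L (γ ζ)) (c := 1 / t) (C := C)
    (by positivity) (fun ζ hζ => (hhd ζ hζ).continuousAt.continuousWithinAt)
    (fun ζ hζ _ => hhd ζ (subset_closure hζ)) (fun ζ hζ hne => hC ζ (hcl ζ hζ) hne)
    (fun ζ hζ hne => (hψd ζ hζ hne).continuousAt.continuousWithinAt)
    (fun ζ hζ hne => hψd ζ (subset_closure hζ) hne) ?_ (x := ((‖y‖ : ℝ) : ℂ))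
    (by simpa using hyt) (by
      rw [hγy]; exact mul_ne_zero (Complex.ofReal_ne_zero.2 hyn.ne') hx.2)
  · simp only [hγy, norm_div, Complex.norm_real, norm_norm] at this
    rw [div_le_div_iff₀ hyn ht0] at this
    rw [div_lt_iff₀ hk0] at ht
    linarith
  · intro ζ hζ hne
    have h1 := hcl ζ (frontier_subset_closure hζ)
    rw [frontier_ball _ ht0.ne'] at hζ
    have h2 : ‖ζ‖ = t := by simpa using hζ
    rw [norm_div, h2]
    gcongr
    exact hk1 _ ⟨hγ1 ζ h1, right_ne_zero_of_mul hne⟩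

/-- Pair `f` with the unit vector along `f x` to reduce to the scalar case. -/
theorem norm_map_le_norm_ballInvolution {L : Cn n → ℂ} (hL : Differentiable ℂ L)
    {f : Cn n → Cn n} (hf : DifferentiableOn ℂ f (slitBall L))
    (hf1 : MapsTo f (slitBall L) (unitBall n)) {w x : Cn n}
    (hw : w ∈ slitBall L) (hx : x ∈ slitBall L) (hfw : f w = 0) :
    ‖f x‖ ≤ ‖ballInvolution w x‖ := by
  by_cases h0 : f x = 0
  · simp [h0]
  set v : Cn n := ((‖f x‖ : ℝ) : ℂ)⁻¹ • f x with hv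
  have hn : 0 < ‖f x‖ := norm_pos_iff.2 h0
  have hv1 : ‖v‖ = 1 := by
    rw [hv, norm_smul, norm_inv, Complex.norm_real, norm_norm]; field_simp
  have := norm_le_norm_ballInvolution hL (k := fun z => inner ℂ v (f z))
    (fun z hz => (innerSL ℂ v).differentiableAt.comp_differentiableWithinAt z (hf z hz)) ?_ hw hx
    (by simp [hfw])
  · refine le_trans (le_of_eq ?_) this
    simp only [hv, inner_smul_left, inner_self_eq_norm_sq_to_K]
    simp
    field_simp
  · intro z hz
    have h1 := norm_inner_le_norm (𝕜 := ℂ) v (f z)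
    rw [hv1, one_mul] at h1
    have h2 : ‖f z‖ < 1 := by simpa [unitBall] using hf1 hz
    exact h1.trans h2.le

/-- The Carathéodory distance of the slit ball is the restriction of that of the ball. -/
theorem caratheodoryDist_slitBall {L : Cn n → ℂ} (hL : Differentiable ℂ L) {w x : Cn n}
    (hw : w ∈ slitBall L) (hx : x ∈ slitBall L) :
    caratheodoryDist (slitBall L) w x = Real.artanh ‖ballInvolution w x‖ := by
  have hy1 : ‖ballInvolution w x‖ < 1 := norm_ballInvolution_lt_one hw.1 hx.1
  refine IsGreatest.csSup_eq ⟨?_, ?_⟩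
  -- The supremum is attained by the component of `φ_w` along `φ_w(x)`; if `y = 0`, then `v = 0` and
  -- the zero function serves.
  · set y := ballInvolution w x with hy
    set v : Cn n := ((‖y‖ : ℝ) : ℂ)⁻¹ • y with hv
    have hv1 : ‖v‖ ≤ 1 := by
      rw [hv, norm_smul, norm_inv, Complex.norm_real, norm_norm]
      exact inv_mul_le_one
    refine ⟨fun z => inner ℂ v (ballInvolution w z), fun z hz =>
      ((innerSL ℂ v).differentiableAt.comp z
        (differentiableAt_ballInvolution hw.1 hz.1)).differentiableWithinAt, ?_, ?_, ?_⟩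
    · intro z hz
      have h1 := norm_inner_le_norm (𝕜 := ℂ) v (ballInvolution w z)
      have h2 : ‖ballInvolution w z‖ < 1 := norm_ballInvolution_lt_one hw.1 hz.1
      rw [mem_ball, dist_zero_right]
      exact h1.trans_lt ((mul_le_of_le_one_left (norm_nonneg _) hv1).trans_lt h2)
    · simp [ballInvolution_self hw.1]
    · change Real.artanh ‖y‖ = Real.artanh ‖(inner ℂ v y : ℂ)‖
      congr 1
      by_cases h0 : ‖y‖ = 0
      · simp [hv, h0]
      · simp only [hv, inner_smul_left, inner_self_eq_norm_sq_to_K]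
        simp
        field_simp
  · rintro _ ⟨k, hk, hk1, hkw, rfl⟩
    refine Real.artanh_le_artanh (by linarith [norm_nonneg (k x)]) hy1 ?_
    exact norm_le_norm_ballInvolution hL hk
      (fun z hz => (by simpa using hk1 hz : ‖k z‖ < 1).le) hw hx hkw

end

/-! ### Bounds for the squeezing function and the Fridman invariant. -/

section

variable {n : ℕ} {L : Cn n → ℂ}

theorem mem_unitBall {z : Cn n} : z ∈ unitBall n ↔ ‖z‖ < 1 := by simp [unitBall]

theorem isPreconnected_unitBall : IsPreconnected (unitBall n) :=
  (convex_ball (0 : Cn n) 1).isPreconnected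

theorem slitBall_subset_unitBall : slitBall L ⊆ unitBall n := fun _ hz => mem_unitBall.2 hz.1

theorem unitBall_subset_closure_slitBall (hL : Differentiable ℂ L) (hne : (slitBall L).Nonempty) :
    unitBall n ⊆ closure (slitBall L) := by
  intro p hp
  by_contra hcl
  obtain ⟨w, hw⟩ := hne
  refine hw.2 (eqOn_zero_of_eqOn_open isOpen_ball isPreconnected_unitBall hL.continuous.continuousOn
    (fun x _ _ => hL x) isClosed_closure.isOpen_compl ⟨p, hp, hcl⟩ ?_ w
    (slitBall_subset_unitBall hw))
  intro x hx
  by_contra h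
  exact hx.2 (subset_closure ⟨mem_unitBall.1 hx.1, h⟩)

/-- For a separation `U`, `V`, the function equal to `L` on the `U` part and `0` elsewhere is
continuous on the ball and holomorphic off its zeros. It vanishes on the `V` part, hence everywhere.
-/
theorem isPreconnected_slitBall (hL : Differentiable ℂ L) : IsPreconnected (slitBall L) := by
  classical
  intro U V hU hV hUV ⟨a, haD, haU⟩ ⟨b, hbD, hbV⟩
  by_contra hcon
  have hdis : ∀ x ∈ slitBall L, x ∈ U → x ∉ V := fun x hx hxU hxV => hcon ⟨x, hx, hxU, hxV⟩
  set h : Cn n → ℂ := (U ∩ slitBall L).indicator L with hh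
  have hD := isOpen_slitBall hL
  have hloc : ∀ x ∈ slitBall L, x ∈ U → h =ᶠ[𝓝 x] L := by
    intro x hx hxU
    filter_upwards [(hU.inter hD).mem_nhds ⟨hxU, hx⟩] with y hy
    rw [hh, indicator_of_mem hy]
  have hd : ∀ x ∈ unitBall n, h x ≠ 0 → DifferentiableAt ℂ h x := by
    intro x _ hx0
    obtain ⟨hxU, hxD⟩ := mem_of_indicator_ne_zero hx0
    exact (hL x).congr_of_eventuallyEq (hloc x hxD hxU)
  have hle : ∀ x, ‖h x‖ ≤ ‖L x‖ := fun x => norm_indicator_le_norm_self _ _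
  have hc : ContinuousOn h (unitBall n) := by
    intro x hx
    refine ContinuousAt.continuousWithinAt ?_
    by_cases hxD : x ∈ slitBall L
    · by_cases hxU : x ∈ U
      · exact ((hL x).congr_of_eventuallyEq (hloc x hxD hxU)).continuousAt
      · have hxV : x ∈ V := (hUV hxD).resolve_left hxU
        have : h =ᶠ[𝓝 x] fun _ => 0 := by
          filter_upwards [(hV.inter hD).mem_nhds ⟨hxV, hxD⟩] with y hy
          rw [hh, indicator_of_notMem fun h' => hdis y hy.2 h'.1 hy.1]
        exact continuousAt_const.congr this.symm
    · have hx0 : L x = 0 := by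
        by_contra h'
        exact hxD ⟨mem_unitBall.1 hx, h'⟩
      have hhx : h x = 0 := by rw [hh, indicator_of_notMem fun h' => hxD h'.2]
      rw [ContinuousAt, hhx]
      refine squeeze_zero_norm hle ?_
      simpa [hx0] using (hL x).continuousAt.norm.tendsto
  have hz := eqOn_zero_of_eqOn_open isOpen_ball isPreconnected_unitBall hc hd (hV.inter hD)
    ⟨b, slitBall_subset_unitBall hbD, hbV, hbD⟩ fun x hx => by
      rw [hh, indicator_of_notMem fun h' => hdis x hx.2.2 h'.1 hx.2.1]
  have := hz a (slitBall_subset_unitBall haD)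
  rw [hh, indicator_of_mem (show a ∈ U ∩ slitBall L from ⟨haU, haD⟩)] at this
  exact haD.2 this

/-- An embedding of the slit ball centred at `w` cannot cover a ball reaching beyond the image
radius of a removed point. -/
theorem squeezingFunction_slitBall_le (hL : Differentiable ℂ L) {w p : Cn n} (hw : w ∈ slitBall L)
    (hp : ‖p‖ < 1) (hLp : L p = 0) :
    squeezingFunction (slitBall L) w ≤ ‖ballInvolution w p‖ := by
  refine Real.sSup_le ?_ (norm_nonneg _)
  rintro ρ ⟨hρ, f, hf, hfm, hinj, hfw, hball⟩
  by_contra! hlt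
  obtain ⟨ρ', hρ', hρ'ρ⟩ := exists_between hlt
  have hD := isOpen_slitBall hL
  have hint : (interior (f '' slitBall L)).Nonempty :=
    ⟨0, mem_interior_iff_mem_nhds.2 (mem_of_superset (ball_mem_nhds _ hρ) hball)⟩
  have : (𝓝[slitBall L] p).NeBot :=
    mem_closure_iff_nhdsWithin_neBot.1
      (unitBall_subset_closure_slitBall hL ⟨w, hw⟩ (mem_unitBall.2 hp))
  have hev : ∀ᶠ x in 𝓝[slitBall L] p, f x ∈ closedBall (0 : Cn n) ρ' := by
    have h1 := (differentiableAt_ballInvolution hw.1 hp).continuousAt.norm.eventually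
      (gt_mem_nhds hρ')
    filter_upwards [mem_nhdsWithin_of_mem_nhds h1, self_mem_nhdsWithin] with x hx hxD
    have := norm_map_le_norm_ballInvolution hL hf hfm hw hxD hfw
    rw [mem_closedBall, dist_zero_right]
    exact this.trans (le_of_lt hx)
  -- As `x → p` the values `f x` stay in a compact ball inside the image, so some `f d` is a cluster
  -- value.
  obtain ⟨q, hq, hclq⟩ := (isCompact_closedBall (0 : Cn n) ρ').exists_mapClusterPt
    (u := f) (f := 𝓝[slitBall L] p)
    (le_principal_iff.2 (Filter.mem_map.2 hev))
  obtain ⟨d, hd, rfl⟩ := hball (closedBall_subset_ball hρ'ρ hq)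
  obtain ⟨s, hs, hsD⟩ := Metric.nhds_basis_closedBall.mem_iff.1 (hD.mem_nhds hd)
  have hN := image_mem_nhds_of_injOn hD (isPreconnected_slitBall hL) hf hinj hint hd
    (closedBall_mem_nhds d hs)
  have hfreq := mapClusterPt_iff_frequently.1 hclq _ hN
  have hpN : p ∉ closedBall d s := fun h => (hsD h).2 hLp
  have hev2 : ∀ᶠ x in 𝓝[slitBall L] p, x ∈ slitBall L ∧ x ∉ closedBall d s := by
    refine eventually_mem_nhdsWithin.and (mem_nhdsWithin_of_mem_nhds ?_)
    exact isClosed_closedBall.isOpen_compl.mem_nhds hpN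
  obtain ⟨x, ⟨y, hy, hyx⟩, hxD, hxN⟩ := (hfreq.and_eventually hev2).exists
  rw [hinj (hsD hy) hxD hyx] at hy
  exact hxN hy

/-- The identity map gives the lower bound. The point `p` gives the upper one, and its direction
supplies the unit vector that bounds the competing radii by `1`. -/
theorem squeezingFunction_slitBall_zero (hL : Differentiable ℂ L) {R : ℝ} (hR0 : 0 < R)
    (hR : R < 1) (hball : ball 0 R ⊆ slitBall L) {p : Cn n} (hp : ‖p‖ = R) (hLp : L p = 0) :
    squeezingFunction (slitBall L) 0 = R := by
  have h0 : (0 : Cn n) ∈ slitBall L := hball (mem_ball_self hR0)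
  refine le_antisymm ?_ ?_
  · have := squeezingFunction_slitBall_le hL h0 (hp.trans_lt hR) hLp
    rwa [norm_ballInvolution_zero_left, hp] at this
  · refine le_csSup ⟨1, ?_⟩ ⟨hR0, id, differentiableOn_id, slitBall_subset_unitBall,
      injOn_id _, rfl, by simpa using hball⟩
    rintro ρ ⟨hρ, f, hf, hfm, hinj, hfw, hb⟩
    by_contra! h1
    have hpos : 0 < ‖p‖ := by rw [hp]; exact hR0
    have hm : ((‖p‖ : ℂ)⁻¹) • p ∈ ball (0 : Cn n) ρ := by
      rw [mem_ball, dist_zero_right, norm_smul, norm_inv, Complex.norm_real, norm_norm,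
        inv_mul_cancel₀ hpos.ne']
      exact h1
    obtain ⟨x, hx, hfx⟩ := hb hm
    have := mem_unitBall.1 (hfm hx)
    rw [hfx, norm_smul, norm_inv, Complex.norm_real, norm_norm, inv_mul_cancel₀ hpos.ne'] at this
    exact lt_irrefl _ this

/-- A ball embedded in the slit ball cannot contain a Carathéodory ball centred at `w` reaching
beyond a removed point. -/
theorem fridmanInvariant_slitBall_le (hL : Differentiable ℂ L) {w p : Cn n} (hw : w ∈ slitBall L)
    (hp : ‖p‖ < 1) (hLp : L p = 0) :
    fridmanInvariant (slitBall L) w ≤ ‖ballInvolution w p‖ := by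
  refine Real.sSup_le ?_ (norm_nonneg _)
  rintro _ ⟨ρ, hρ, rfl, f, hf, hfm, hinj, hsub⟩
  by_contra! hlt
  have hD := isOpen_slitBall hL
  have hBo : IsOpen (unitBall n) := isOpen_ball
  set B := unitBall n with hB
  have hφc : ContinuousOn (fun x => ‖ballInvolution w x‖) B := fun x hx =>
    (differentiableAt_ballInvolution hw.1 (mem_unitBall.1 hx)).continuousAt.norm.continuousWithinAt
  -- A ball for the Carathéodory distance of the full ball; it contains `p`, and its part off the
  -- slit lies in `f(B)`.
  set V : Set (Cn n) := B ∩ (fun x => ‖ballInvolution w x‖) ⁻¹' Iio (Real.tanh ρ) with hVdef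
  have hV : IsOpen V := hφc.isOpen_inter_preimage hBo isOpen_Iio
  have hVf : V ∩ slitBall L ⊆ f '' B := by
    rintro x ⟨hxV, hxD⟩
    refine hsub ⟨hxD, ?_⟩
    rw [caratheodoryDist_slitBall hL hw hxD, ← Real.artanh_tanh ρ]
    exact Real.artanh_lt_artanh (by linarith [norm_nonneg (ballInvolution w x)])
      (Real.tanh_lt_one ρ) hxV.2
  have hV'o : IsOpen (V ∩ slitBall L) := hV.inter hD
  have hpV : p ∈ V := ⟨mem_unitBall.2 hp, hlt⟩
  have hint : (interior (f '' B)).Nonempty := by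
    refine ⟨w, mem_interior_iff_mem_nhds.2 (mem_of_superset (hV'o.mem_nhds ⟨⟨?_, ?_⟩, hw⟩) hVf)⟩
    · exact slitBall_subset_unitBall hw
    · rw [mem_preimage, ballInvolution_self hw.1, norm_zero]
      exact (norm_nonneg _).trans_lt hlt
  set g := Function.invFunOn f B with hg
  have hgf : ∀ x ∈ B, g (f x) = x := fun x hx => hinj.leftInvOn_invFunOn hx
  have hgB : ∀ y ∈ f '' B, g y ∈ B := fun y hy => Function.invFunOn_mem hy
  have hgc : ∀ y ∈ f '' B, ContinuousAt g y := by
    rintro _ ⟨a, ha, rfl⟩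
    exact continuousAt_invFunOn_of_injOn hBo isPreconnected_unitBall hf hinj hint ha
  -- A closed disc centred at `p` whose boundary circle avoids the zeros of `L`.
  set b := w - p with hb
  obtain ⟨ε, hε, hεV, hεL⟩ : ∃ ε > 0, (∀ ζ : ℂ, ‖ζ‖ ≤ ε → p + ζ • b ∈ V) ∧
      ∀ ζ : ℂ, ‖ζ‖ = ε → L (p + ζ • b) ≠ 0 := by
    have hline : Continuous fun ζ : ℂ => p + ζ • b := by fun_prop
    have h1 : ∀ᶠ ζ in 𝓝 (0 : ℂ), p + ζ • b ∈ V :=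
      hline.continuousAt.eventually (hV.mem_nhds (by simpa using hpV))
    have hdiff : Differentiable ℂ fun ζ : ℂ => L (p + ζ • b) :=
      hL.comp (by fun_prop : Differentiable ℂ fun ζ : ℂ => p + ζ • b)
    have han : AnalyticOnNhd ℂ (fun ζ : ℂ => L (p + ζ • b)) univ :=
      hdiff.differentiableOn.analyticOnNhd isOpen_univ
    -- On this line `L` is not identically zero: at `ζ = 1` the point is `w`.
    have h2 : ∀ᶠ ζ in 𝓝[≠] (0 : ℂ), L (p + ζ • b) ≠ 0 := by
      refine (han 0 (mem_univ _)).eventually_eq_zero_or_eventually_ne_zero.resolve_left fun h => ?_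
      have := han.eqOn_zero_of_preconnected_of_eventuallyEq_zero isPreconnected_univ
        (mem_univ 0) h (mem_univ 1)
      simp only [one_smul, hb, add_sub_cancel, Pi.zero_apply] at this
      exact hw.2 this
    rw [eventually_nhdsWithin_iff] at h2
    obtain ⟨ε, hε, h⟩ := Metric.eventually_nhds_iff.1 (h1.and h2)
    refine ⟨ε / 2, by positivity, fun ζ hζ => (h (by rw [dist_zero_right]; linarith)).1,
      fun ζ hζ => (h (by rw [dist_zero_right]; linarith)).2 ?_⟩
    rintro rfl
    rw [norm_zero] at hζ
    linarith
  set Q := (fun ζ : ℂ => p + ζ • b) '' sphere 0 ε with hQ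
  set Q' := (fun ζ : ℂ => p + ζ • b) '' closedBall 0 ε with hQ'
  have hQc : IsCompact Q := (isCompact_sphere 0 ε).image (by fun_prop)
  have hQ'c : IsCompact Q' := (isCompact_closedBall 0 ε).image (by fun_prop)
  have hQV : Q ⊆ V ∩ slitBall L := by
    rintro _ ⟨ζ, hζ, rfl⟩
    have hζ' : ‖ζ‖ = ε := by simpa using hζ
    have := hεV ζ hζ'.le
    exact ⟨this, mem_unitBall.1 this.1, hεL ζ hζ'⟩
  have hQ'V : Q' ⊆ V := by
    rintro _ ⟨ζ, hζ, rfl⟩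
    exact hεV ζ (by simpa using hζ)
  -- For `x` near `p` the translated circle stays off the slit, in one compact set, and the
  -- translated disc stays in `V`.
  obtain ⟨κ₁, hκ₁, hκ₁Q⟩ := hQc.exists_cthickening_subset_open hV'o hQV
  obtain ⟨κ₂, hκ₂, hκ₂Q⟩ := hQ'c.exists_thickening_subset_open hV hQ'V
  have hcirc : ∀ x ∈ ball p κ₁, ∀ ζ : ℂ, ‖ζ‖ = ε → x + ζ • b ∈ cthickening κ₁ Q := by
    intro x hx ζ hζ
    refine mem_cthickening_of_dist_le _ (p + ζ • b) _ _ ⟨ζ, by simpa using hζ, rfl⟩ ?_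
    rw [dist_add_right]
    exact (mem_ball.1 hx).le
  have hdisc : ∀ x ∈ ball p κ₂, ∀ ζ : ℂ, ‖ζ‖ ≤ ε → x + ζ • b ∈ V := by
    intro x hx ζ hζ
    refine hκ₂Q (mem_thickening_iff.2 ⟨p + ζ • b, ⟨ζ, by simpa using hζ, rfl⟩, ?_⟩)
    rwa [dist_add_right]
  obtain ⟨c, hc0, hc1, hgle⟩ : ∃ c : ℝ, 0 ≤ c ∧ c < 1 ∧ ∀ y ∈ cthickening κ₁ Q, ‖g y‖ ≤ c := by
    have hne : (cthickening κ₁ Q).Nonempty :=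
      ((NormedSpace.sphere_nonempty.2 hε.le).image _).mono (self_subset_cthickening _)
    obtain ⟨y, hy, hmax⟩ := hQc.cthickening.exists_isMaxOn hne (f := fun y => ‖g y‖)
      fun y hy => (hgc y (hVf (hκ₁Q hy))).norm.continuousWithinAt
    exact ⟨‖g y‖, norm_nonneg _, mem_unitBall.1 (hgB y (hVf (hκ₁Q hy))), fun z hz => hmax hz⟩
  -- By the maximum principle the inverse stays away from the unit sphere near `p`.
  have key : ∀ x ∈ ball p κ₁ ∩ ball p κ₂, x ∈ slitBall L → jacobian f (g x) ≠ 0 → ‖g x‖ ≤ c := by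
    rintro x ⟨hx1, hx2⟩ hxD hxj
    set v := g x with hv
    have hdline : Differentiable ℂ fun ζ : ℂ => x + ζ • b := by fun_prop
    obtain ⟨A, hA⟩ := (isCompact_closedBall (0 : ℂ) ε).exists_bound_of_continuousOn
      (f := fun ζ : ℂ => L (x + ζ • b)) (hL.continuous.comp (by fun_prop)).continuousOn
    have hxB : x ∈ f '' B := hVf
      (show x ∈ V ∩ slitBall L from
        ⟨by simpa using hdisc x hx2 0 (by simpa using hε.le), hxD⟩)
    have hv1 : ‖v‖ ≤ 1 := (mem_unitBall.1 (hgB x hxB)).le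
    have hLx : 0 < ‖L x‖ := norm_pos_iff.2 hxD.2
    have hA0 : 0 ≤ A := (norm_nonneg _).trans (hA 0 (by simpa using hε.le))
    have hN : ∀ N : ℕ, (‖v‖ ^ 2) ^ N * ‖L x‖ ≤ (‖v‖ * c) ^ N * A := by
      intro N
      by_contra! hcon
      -- `m` is the modulus at the centre of `⟨v, g⟩ ^ N * L`. Cutting the disc at `|L| = m / 2`
      -- avoids the slit, where `g` is uncontrolled, and the new boundary contributes at most `m / 2
      -- < m`.
      set m := (‖v‖ ^ 2) ^ N * ‖L x‖ with hm
      have hm0 : 0 < m := lt_of_le_of_lt (by positivity) hcon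
      have hmL : m ≤ ‖L x‖ := mul_le_of_le_one_left hLx.le
        (pow_le_one₀ (by positivity) (pow_le_one₀ (norm_nonneg _) hv1))
      set W : Set ℂ := ball 0 ε ∩ {ζ | m / 2 < ‖L (x + ζ • b)‖} with hW
      have hWo : IsOpen W := isOpen_ball.inter
        (isOpen_lt continuous_const (hL.continuous.comp (by fun_prop)).norm)
      have hWc : ∀ ζ ∈ closure W, ‖ζ‖ ≤ ε ∧ m / 2 ≤ ‖L (x + ζ • b)‖ := by
        intro ζ hζ
        have hcl : IsClosed {ζ : ℂ | ‖ζ‖ ≤ ε ∧ m / 2 ≤ ‖L (x + ζ • b)‖} :=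
          (isClosed_le continuous_norm continuous_const).inter
            (isClosed_le continuous_const (hL.continuous.comp (by fun_prop)).norm)
        have hWsub : W ⊆ {ζ : ℂ | ‖ζ‖ ≤ ε ∧ m / 2 ≤ ‖L (x + ζ • b)‖} := fun ζ hζ =>
          ⟨(by simpa using hζ.1 : ‖ζ‖ < ε).le, le_of_lt hζ.2⟩
        exact closure_minimal hWsub hcl hζ
      have hWm : ∀ ζ ∈ closure W, x + ζ • b ∈ V ∩ slitBall L := by
        intro ζ hζ
        obtain ⟨h1, h2⟩ := hWc ζ hζ
        have h3 := hdisc x hx2 ζ h1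
        exact ⟨h3, mem_unitBall.1 h3.1, norm_pos_iff.1 (by linarith)⟩
      have hgcl : ∀ ζ ∈ closure W, ContinuousAt (fun ζ : ℂ => g (x + ζ • b)) ζ := fun ζ hζ =>
        (hgc _ (hVf (hWm ζ hζ))).comp (f := fun ζ : ℂ => x + ζ • b) hdline.continuous.continuousAt
      have hgcB : ∀ ζ ∈ closure W, g (x + ζ • b) ∈ B := fun ζ hζ => hgB _ (hVf (hWm ζ hζ))
      have hgd : ∀ ζ ∈ closure W, jacobian f (g (x + ζ • b)) ≠ 0 →
          DifferentiableAt ℂ (fun ζ : ℂ => g (x + ζ • b)) ζ := by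
        intro ζ hζ hj
        refine DifferentiableAt.comp ζ (f := fun ζ : ℂ => x + ζ • b)
          (differentiableAt_of_local_left_inverse hBo hf (hgcB ζ hζ) hj
            (hgc _ (hVf (hWm ζ hζ))) ?_) (hdline ζ)
        filter_upwards [hV'o.mem_nhds (hWm ζ hζ)] with z hz
        exact Function.invFunOn_eq (hVf hz)
      have hψc : ∀ ζ ∈ closure W, ContinuousAt
          (fun ζ : ℂ => (inner ℂ v (g (x + ζ • b)) : ℂ) ^ N * L (x + ζ • b)) ζ := fun ζ hζ =>
        (((innerSL ℂ v).continuous.continuousAt.comp (hgcl ζ hζ)).pow N).mul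
          (hL.continuous.comp hdline.continuous).continuousAt
      have hψd : ∀ ζ ∈ closure W, jacobian f (g (x + ζ • b)) ≠ 0 → DifferentiableAt ℂ
          (fun ζ : ℂ => (inner ℂ v (g (x + ζ • b)) : ℂ) ^ N * L (x + ζ • b)) ζ := fun ζ hζ hj =>
        (((innerSL ℂ v).differentiableAt.comp ζ (hgd ζ hζ hj)).pow N).mul ((hL _).comp ζ (hdline ζ))
      have hin : ∀ ζ : ℂ, ‖(inner ℂ v (g (x + ζ • b)) : ℂ)‖ ≤ ‖v‖ * ‖g (x + ζ • b)‖ := fun ζ =>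
        norm_inner_le_norm _ _
      have hψb : ∀ ζ ∈ closure W,
          ‖(inner ℂ v (g (x + ζ • b)) : ℂ) ^ N * L (x + ζ • b)‖ ≤ ‖L (x + ζ • b)‖ := by
        intro ζ hζ
        rw [norm_mul, norm_pow]
        refine mul_le_of_le_one_left (norm_nonneg _) (pow_le_one₀ (norm_nonneg _) ?_)
        exact (hin ζ).trans (mul_le_one₀ hv1 (norm_nonneg _) (mem_unitBall.1 (hgcB ζ hζ)).le)
      have := norm_le_of_frontier_off_zeros (W := W) hWo (isBounded_ball.subset inter_subset_left)
        (ψ := fun ζ : ℂ => (inner ℂ v (g (x + ζ • b)) : ℂ) ^ N * L (x + ζ • b))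
        (h := fun ζ : ℂ => jacobian f (g (x + ζ • b)))
        (c := max ((‖v‖ * c) ^ N * A) (m / 2)) (C := A) (le_max_of_le_right (by positivity))
        (fun ζ hζ => ((differentiableAt_jacobian hBo hf (hgcB ζ hζ)).continuousAt.comp
          (f := fun ζ : ℂ => g (x + ζ • b)) (hgcl ζ hζ)).continuousWithinAt)
        (fun ζ hζ hj => (differentiableAt_jacobian hBo hf (hgcB ζ (subset_closure hζ))).comp ζ
          (f := fun ζ : ℂ => g (x + ζ • b)) (hgd ζ (subset_closure hζ) hj))
        (fun ζ hζ _ => (hψb ζ hζ).trans (hA ζ (by simpa using (hWc ζ hζ).1)))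
        (fun ζ hζ _ => (hψc ζ hζ).continuousWithinAt)
        (fun ζ hζ hj => hψd ζ (subset_closure hζ) hj) ?_ (x := 0)
        ⟨by simpa using hε, by
          simp only [mem_ofPred_eq, zero_smul, add_zero]; linarith⟩ (by simpa using hxj)
      · simp only [zero_smul, add_zero, ← hv, inner_self_eq_norm_sq_to_K, norm_mul, norm_pow] at this
        simp only [RCLike.norm_ofReal, abs_norm, ← hm] at this
        rcases le_max_iff.1 this with h | h <;> linarith
      · intro ζ hζ _
        have hζc := frontier_subset_closure hζ
        obtain ⟨h1, h2⟩ := hWc ζ hζc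
        rcases h1.lt_or_eq with h1 | h1
        · refine le_max_of_le_right ((hψb ζ hζc).trans ?_)
          by_contra! h3
          have : ζ ∈ W := ⟨by simpa using h1, h3⟩
          rw [frontier, hWo.interior_eq] at hζ
          exact hζ.2 this
        · refine le_max_of_le_left ?_
          rw [norm_mul, norm_pow]
          gcongr
          · refine (hin ζ).trans ?_
            gcongr
            exact hgle _ (hcirc x hx1 ζ h1)
          · exact hA ζ (by simpa using h1.le)
    have h := le_of_forall_pow_mul_le (by positivity) hLx hN
    by_contra! hlt'
    have : 0 < ‖v‖ := hc0.trans_lt hlt'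
    nlinarith
  have hKcl : IsClosed (f '' closedBall 0 c) :=
    ((isCompact_closedBall (0 : Cn n) c).image_of_continuousOn
      (hf.continuousOn.mono (closedBall_subset_ball hc1))).isClosed
  have hpK : p ∉ f '' closedBall 0 c := by
    rintro ⟨a, ha, rfl⟩
    exact (hfm (closedBall_subset_ball hc1 ha)).2 hLp
  set O := (ball p κ₁ ∩ ball p κ₂) ∩ (f '' closedBall 0 c)ᶜ with hO
  have hOo : IsOpen O := (isOpen_ball.inter isOpen_ball).inter hKcl.isOpen_compl
  have hpO : p ∈ O := ⟨⟨mem_ball_self hκ₁, mem_ball_self hκ₂⟩, hpK⟩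
  obtain ⟨x, hxO, hxD⟩ := mem_closure_iff.1
    (unitBall_subset_closure_slitBall hL ⟨w, hw⟩ (mem_unitBall.2 hp)) O hOo hpO
  obtain ⟨a, ha, hax⟩ := hVf (show x ∈ V ∩ slitBall L from
    ⟨by simpa using hdisc x hxO.1.2 0 (by simpa using hε.le), hxD⟩)
  -- `key` needs a nonzero Jacobian, so the point of `O` is replaced by a nearby image point having
  -- one.
  have hpre : IsOpen (B ∩ f ⁻¹' O) := hf.continuousOn.isOpen_inter_preimage hBo hOo
  obtain ⟨y, ⟨-, hyB, hyO⟩, hyj⟩ := exists_jacobian_ne_zero hBo isPreconnected_unitBall hf hint hpre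
    ⟨a, ha, ha, by rw [mem_preimage, hax]; exact hxO⟩
  have := key (f y) hyO.1 (hfm hyB) (by rwa [hgf y hyB])
  rw [hgf y hyB] at this
  exact hyO.2 ⟨y, by simpa using this, rfl⟩

/-- The Carathéodory ball about `0` of radius `artanh R` lies in the image of `z ↦ R z`. -/
theorem le_fridmanInvariant_slitBall_zero (hL : Differentiable ℂ L) {R : ℝ} (hR0 : 0 < R)
    (hR : R < 1) (hball : ball 0 R ⊆ slitBall L) : R ≤ fridmanInvariant (slitBall L) 0 := by
  have h0 : (0 : Cn n) ∈ slitBall L := hball (mem_ball_self hR0)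
  have hRI : R ∈ Ioo (-1 : ℝ) 1 := ⟨by linarith, hR⟩
  refine le_csSup ⟨1, ?_⟩ ⟨Real.artanh R, Real.artanh_pos ⟨hR0, hR⟩,
    (Real.tanh_artanh hRI).symm, fun z => (R : ℂ) • z, by fun_prop, ?_, ?_, ?_⟩
  · rintro _ ⟨ρ, -, rfl, -⟩
    exact (Real.tanh_lt_one ρ).le
  · intro z hz
    refine hball ?_
    have := mem_unitBall.1 hz
    rw [mem_ball, dist_zero_right, norm_smul, Complex.norm_real, Real.norm_of_nonneg hR0.le]
    nlinarith
  · exact (smul_right_injective _ (Complex.ofReal_ne_zero.2 hR0.ne')).injOn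
  · rintro x ⟨hxD, hx⟩
    rw [caratheodoryDist_slitBall hL h0 hxD, norm_ballInvolution_zero_left,
      Real.artanh_lt_artanh_iff ⟨by linarith [norm_nonneg x], hxD.1⟩ hRI] at hx
    refine ⟨((R : ℝ) : ℂ)⁻¹ • x, mem_unitBall.2 ?_, ?_⟩
    · rw [norm_smul, norm_inv, Complex.norm_real, Real.norm_of_nonneg hR0.le, inv_mul_lt_iff₀ hR0]
      simpa using hx
    · simp only [smul_smul]
      rw [mul_inv_cancel₀ (Complex.ofReal_ne_zero.2 hR0.ne'), one_smul]

end

/-! ### Pseudoconvexity, failure of the mean value inequality, and the hyperplanes. -/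

section

variable {n : ℕ} {L : Cn n → ℂ}

theorem re_le_circleAverage {F : ℂ → ℂ} {v : ℂ → ℝ} (hF : DifferentiableOn ℂ F (closedBall 0 1))
    (hv : CircleIntegrable v 0 1) (h : ∀ ζ ∈ sphere (0 : ℂ) 1, (F ζ).re ≤ v ζ) :
    (F 0).re ≤ Real.circleAverage v 0 1 := by
  have hd : DiffContOnCl ℂ F (ball 0 |1|) := by
    rw [abs_one]
    refine DifferentiableOn.diffContOnCl ?_
    rwa [closure_ball _ one_ne_zero]
  have hFi : CircleIntegrable F 0 1 :=
    (hF.continuousOn.mono sphere_subset_closedBall).circleIntegrable zero_le_one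
  have hre : CircleIntegrable (fun ζ => (F ζ).re) 0 1 :=
    (Complex.continuous_re.comp_continuousOn
      (hF.continuousOn.mono sphere_subset_closedBall)).circleIntegrable zero_le_one
  rw [← hd.circleAverage]
  have := Complex.reCLM.circleAverage_comp_comm hFi
  calc (Real.circleAverage F 0 1).re = Real.circleAverage (fun ζ => (F ζ).re) 0 1 := this.symm
    _ ≤ _ := Real.circleAverage_mono hre hv (by rwa [abs_one])

/-- The graph of the convex function `1 / (1 - t)` lies above its tangent at `s`. -/
theorem inv_one_sub_add_le {s t : ℝ} (hs : s < 1) (ht : t < 1) :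
    (1 - s)⁻¹ + (t - s) / (1 - s) ^ 2 ≤ (1 - t)⁻¹ := by
  have h1 : 0 < 1 - s := by linarith
  have h2 : 0 < 1 - t := by linarith
  have : (1 - s)⁻¹ + (t - s) / (1 - s) ^ 2 = (1 - s + (t - s)) / (1 - s) ^ 2 := by field_simp
  rw [this, ← one_div, div_le_div_iff₀ (by positivity) h2]
  nlinarith [sq_nonneg (t - s)]

/-- The exhaustion is `1 / (1 - ‖z‖²) + 1 / |L|`. On each disc it dominates the real part of a
holomorphic function and equals it at the centre. -/
theorem isPseudoconvexDomain_slitBall (hL : Differentiable ℂ L) (hne : (slitBall L).Nonempty) :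
    IsPseudoconvexDomain (slitBall L) := by
  refine ⟨isOpen_slitBall hL, ⟨hne, isPreconnected_slitBall hL⟩,
    fun z => (1 - ‖z‖ ^ 2)⁻¹ + ‖L z‖⁻¹, ?_⟩
  have hpos : ∀ z ∈ slitBall L, 0 < 1 - ‖z‖ ^ 2 := fun z hz => by
    nlinarith [hz.1, norm_nonneg z]
  have hcont : ContinuousOn (fun z => (1 - ‖z‖ ^ 2)⁻¹ + ‖L z‖⁻¹) (slitBall L) := by
    refine ContinuousOn.add (ContinuousOn.inv₀ (by fun_prop) fun z hz => (hpos z hz).ne')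
      (ContinuousOn.inv₀ hL.continuous.norm.continuousOn fun z hz => norm_ne_zero_iff.2 hz.2)
  refine ⟨hcont, ⟨hcont.upperSemicontinuousOn, fun a b hab => ?_⟩, fun c => ?_⟩
  · have ha : a ∈ slitBall L := by simpa using hab 0 (by simp)
    have hint : CircleIntegrable
        (fun ζ : ℂ => (1 - ‖a + ζ • b‖ ^ 2)⁻¹ + ‖L (a + ζ • b)‖⁻¹) 0 1 := by
      refine ContinuousOn.circleIntegrable zero_le_one (hcont.comp (by fun_prop) fun ζ hζ => ?_)
      exact hab ζ (by simpa using (mem_sphere.1 hζ).le)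
    refine ⟨hint, ?_⟩
    set s : ℝ := ‖a‖ ^ 2 with hs
    have hs1 : s < 1 := by linarith [hpos a ha]
    -- The tangent inequality at `s = ‖a‖²` with the term `‖b‖²` dropped, plus `1 / L` rotated to be
    -- positive at `a`.
    set F : ℂ → ℂ := fun ζ => ((1 - s)⁻¹ : ℝ) + ((2 / (1 - s) ^ 2 : ℝ) : ℂ) * (ζ * inner ℂ a b) +
      L a / (‖L a‖ : ℝ) * (L (a + ζ • b))⁻¹ with hF
    have hFd : DifferentiableOn ℂ F (closedBall 0 1) := by
      intro ζ hζ
      have hζL : L (a + ζ • b) ≠ 0 := (hab ζ (by simpa using hζ)).2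
      have h1 : DifferentiableAt ℂ (fun ζ : ℂ => L (a + ζ • b)) ζ :=
        (hL _).comp ζ (f := fun ζ : ℂ => a + ζ • b) (by fun_prop)
      have h2 := (h1.fun_inv hζL).const_mul (L a / (‖L a‖ : ℝ))
      refine DifferentiableAt.differentiableWithinAt (DifferentiableAt.add (by fun_prop) h2)
    have hF0 : (F 0).re = (1 - ‖a‖ ^ 2)⁻¹ + ‖L a‖⁻¹ := by
      have : F 0 = (((1 - ‖a‖ ^ 2)⁻¹ + ‖L a‖⁻¹ : ℝ) : ℂ) := by
        have := ha.2
        simp only [hF, zero_mul, mul_zero, add_zero, zero_smul, hs]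
        rw [div_mul_eq_mul_div, mul_inv_cancel₀ this]
        push_cast
        ring
      rw [this, Complex.ofReal_re]
    have := re_le_circleAverage hFd hint ?_
    · rwa [hF0] at this
    · intro ζ hζ
      have hζ1 : ‖ζ‖ = 1 := by simpa using hζ
      have hm := hab ζ hζ1.le
      have hexp : ‖a + ζ • b‖ ^ 2 = s + 2 * (ζ * inner ℂ a b).re + ‖b‖ ^ 2 := by
        rw [norm_add_sq (𝕜 := ℂ), inner_smul_right, norm_smul, hζ1, one_mul]
        rfl
      have h1 := inv_one_sub_add_le hs1 (t := ‖a + ζ • b‖ ^ 2) (by linarith [hpos _ hm])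
      have h2 : (L a / (‖L a‖ : ℝ) * (L (a + ζ • b))⁻¹).re ≤ ‖L (a + ζ • b)‖⁻¹ := by
        refine (Complex.re_le_norm _).trans (le_of_eq ?_)
        rw [norm_mul, norm_div, norm_inv, Complex.norm_real, norm_norm,
          div_self (norm_ne_zero_iff.2 ha.2), one_mul]
      have h3 : (2 / (1 - s) ^ 2) * (ζ * inner ℂ a b).re ≤
          (‖a + ζ • b‖ ^ 2 - s) / (1 - s) ^ 2 := by
        rw [hexp, div_mul_eq_mul_div]
        gcongr
        nlinarith [sq_nonneg ‖b‖]
      simp only [hF, Complex.add_re, Complex.ofReal_re, Complex.re_ofReal_mul]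
      linarith
  · set c' := max c 1 with hc'
    have hc0 : 0 < c' := lt_of_lt_of_le one_pos (le_max_right _ _)
    refine ⟨{z | ‖z‖ ^ 2 ≤ 1 - c'⁻¹} ∩ {z | c'⁻¹ ≤ ‖L z‖}, ?_, ?_, ?_⟩
    · refine Metric.isCompact_of_isClosed_isBounded ?_ ?_
      · exact (isClosed_le (by fun_prop) continuous_const).inter
          (isClosed_le continuous_const hL.continuous.norm)
      · refine (isBounded_closedBall (x := (0 : Cn n)) (r := 1)).subset fun z hz => ?_
        have h1 : ‖z‖ ^ 2 ≤ 1 - c'⁻¹ := hz.1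
        have h2 : 0 < c'⁻¹ := inv_pos.2 hc0
        rw [mem_closedBall, dist_zero_right]
        nlinarith [norm_nonneg z]
    · rintro z ⟨h1, h3⟩
      have h1 : ‖z‖ ^ 2 ≤ 1 - c'⁻¹ := h1
      have h2 : 0 < c'⁻¹ := inv_pos.2 hc0
      refine ⟨?_, norm_pos_iff.1 (h2.trans_le h3)⟩
      nlinarith [norm_nonneg z]
    · rintro z ⟨hz, hzc⟩
      have hzc : (1 - ‖z‖ ^ 2)⁻¹ + ‖L z‖⁻¹ < c := hzc
      have h1 := hpos z hz
      have h2 : 0 < ‖L z‖ := norm_pos_iff.2 hz.2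
      have h3 : c ≤ c' := le_max_left _ _
      have h4 := inv_pos.2 h1
      have h5 := inv_pos.2 h2
      constructor
      · have := inv_le_of_inv_le₀ h1 (by linarith : (1 - ‖z‖ ^ 2)⁻¹ ≤ c')
        change ‖z‖ ^ 2 ≤ 1 - c'⁻¹
        linarith
      · exact inv_le_of_inv_le₀ h2 (by linarith : ‖L z‖⁻¹ ≤ c')

/-- Integrability on the circle is part of the assumed plurisubharmonicity, so no regularity of `u`
is needed; the integral of a positive function is positive. -/
theorem not_isPlurisubharmonicOn_of_lt {u : Cn n → ℝ} {D : Set (Cn n)} {b : Cn n} {R : ℝ}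
    (hb : ∀ ζ : ℂ, ‖ζ‖ ≤ 1 → ζ • b ∈ D) (h0 : R ≤ u 0)
    (hlt : ∀ ζ : ℂ, ‖ζ‖ = 1 → u (ζ • b) < R) : ¬ IsPlurisubharmonicOn u D := by
  rintro ⟨-, h⟩
  obtain ⟨hint, hle⟩ := h 0 b (by simpa using hb)
  simp only [zero_add] at hint hle
  have hpos : 0 < ∫ θ in (0 : ℝ)..2 * Real.pi, (R - u (circleMap 0 1 θ • b)) := by
    refine intervalIntegral.intervalIntegral_pos_of_pos
      (intervalIntegrable_const.sub hint) (fun θ => sub_pos.2 (hlt _ (by simp))) Real.two_pi_pos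
  rw [intervalIntegral.integral_sub intervalIntegrable_const hint] at hpos
  simp only [intervalIntegral.integral_const, sub_zero, smul_eq_mul] at hpos
  rw [Real.circleAverage_def, smul_eq_mul] at hle
  have h2 := h0.trans hle
  rw [inv_mul_eq_div, le_div_iff₀ Real.two_pi_pos] at h2
  linarith

/-- Lets the distance formula for slit balls cover the full ball. -/
theorem slitBall_one : slitBall (fun _ : Cn n => (1 : ℂ)) = unitBall n := by
  ext z
  simp [slitBall, mem_unitBall]

theorem tanh_caratheodoryDist_unitBall {w x : Cn n} (hw : ‖w‖ < 1) (hx : ‖x‖ < 1) :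
    Real.tanh (caratheodoryDist (unitBall n) w x) = ‖ballInvolution w x‖ := by
  rw [← slitBall_one, caratheodoryDist_slitBall (differentiable_const _) ⟨hw, one_ne_zero⟩
    ⟨hx, one_ne_zero⟩, Real.tanh_artanh]
  exact ⟨by linarith [norm_nonneg (ballInvolution w x)], norm_ballInvolution_lt_one hw hx⟩

theorem norm_dilate {r R : ℝ} (hr : 0 < r) (hR : 0 < R) {z : Cn n}
    (hz : z ∈ sphere (0 : Cn n) r) : ‖dilate r R z‖ = R := by
  have hz : ‖z‖ = r := by simpa using hz
  rw [dilate, norm_smul, Complex.norm_real, Real.norm_of_nonneg (by positivity), hz]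
  field_simp

theorem inner_dilate {r R : ℝ} (hr : 0 < r) {z : Cn n} (hz : z ∈ sphere (0 : Cn n) r) :
    inner ℂ z (dilate r R z) = ((r * R : ℝ) : ℂ) := by
  have hz : ‖z‖ = r := by simpa using hz
  rw [dilate, inner_smul_right, inner_self_eq_norm_sq_to_K, hz]
  change ((R / r : ℝ) : ℂ) * (r : ℂ) ^ 2 = _
  rw [← Complex.ofReal_pow, ← Complex.ofReal_mul]
  congr 1
  field_simp

theorem exists_isAdmissibleRadius (n : ℕ) {r R : ℝ} (hr : 0 < r) (hrR : r < R) (hR : R < 1) :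
    ∃ δ : ℝ, IsAdmissibleRadius n r R δ := by
  have hR0 : 0 < R := hr.trans hrR
  have hc1 : ContinuousAt (fun δ : ℝ => r + δ) 0 := by fun_prop
  have hc2 : ContinuousAt (fun δ : ℝ => (1 - r * R + R * δ) ^ 2 + (r + δ) ^ 2) 0 := by fun_prop
  have h1 : ∀ᶠ δ in 𝓝 (0 : ℝ), r + δ < 1 :=
    hc1.eventually (gt_mem_nhds (by linarith))
  have h2 : ∀ᶠ δ in 𝓝 (0 : ℝ), (1 - r * R + R * δ) ^ 2 + (r + δ) ^ 2 < 1 := by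
    -- At `δ = 0` the condition is `r (1 + R²) < 2 R`, which follows from `r < R < 1`. In general it
    -- ensures `|1 - ⟨p, w⟩|² < 1 - ‖w‖²`, which is `‖φ_p(w)‖ < R` when `‖p‖ = R`.
    refine hc2.eventually (gt_mem_nhds ?_)
    have h3 : r * (1 + R ^ 2) < 2 * R := by nlinarith [mul_pos hR0 hR0]
    nlinarith [mul_pos hr (sub_pos.2 h3)]
  obtain ⟨δ, ⟨hδ1, hδ2⟩, hδ⟩ := (((h1.and h2).filter_mono
    (nhdsWithin_le_nhds (s := Ioi 0))).and self_mem_nhdsWithin).exists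
  have hδ : 0 < δ := hδ
  refine ⟨δ, hδ, fun z hz => ?_⟩
  have hzn : ‖z‖ = r := by simpa using hz
  have hw : ∀ w ∈ ball z δ, ‖w‖ < r + δ := fun w hw => by
    have := norm_le_norm_add_norm_sub' w z
    rw [mem_ball, dist_eq_norm] at hw
    linarith
  refine ⟨fun w hwz => mem_unitBall.2 ((hw w hwz).trans hδ1), fun w hwz => ?_⟩
  have hpn := norm_dilate hr hR0 hz
  have hp1 : ‖dilate r R z‖ < 1 := by rw [hpn]; exact hR
  have hwn := hw w hwz
  have hw1 : ‖w‖ < 1 := hwn.trans hδ1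
  rw [tanh_caratheodoryDist_unitBall hp1 hw1]
  have hid := one_sub_norm_ballInvolution_sq hp1 hw1
  set p := dilate r R z with hp
  have hne := norm_pos_iff.2 (one_sub_inner_ne_zero hp1 hw1)
  have hpz : inner ℂ p z = ((r * R : ℝ) : ℂ) := by
    rw [← inner_conj_symm, hp, inner_dilate hr hz, Complex.conj_ofReal]
  have hin : ‖(1 : ℂ) - inner ℂ p w‖ ≤ 1 - r * R + R * δ := by
    have h3 : (1 : ℂ) - inner ℂ p w = ((1 - r * R : ℝ) : ℂ) - inner ℂ p (w - z) := by
      rw [inner_sub_right, hpz]; push_cast; ring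
    rw [h3]
    refine (norm_sub_le _ _).trans (add_le_add ?_ ?_)
    · rw [Complex.norm_real, Real.norm_of_nonneg (by nlinarith)]
    · refine (norm_inner_le_norm _ _).trans ?_
      rw [hpn]
      gcongr
      rw [← dist_eq_norm]
      exact (mem_ball.1 hwz).le
  have h4 : ‖(1 : ℂ) - inner ℂ p w‖ ^ 2 < 1 - ‖w‖ ^ 2 := by
    have h5 : ‖(1 : ℂ) - inner ℂ p w‖ ^ 2 ≤ (1 - r * R + R * δ) ^ 2 := by gcongr
    have h6 : ‖w‖ ^ 2 ≤ (r + δ) ^ 2 := by gcongr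
    linarith
  rw [hpn] at hid
  have h7 : (1 - R ^ 2) * ‖(1 : ℂ) - inner ℂ p w‖ ^ 2 <
      (1 - ‖ballInvolution p w‖ ^ 2) * ‖(1 : ℂ) - inner ℂ p w‖ ^ 2 := by
    rw [hid]
    exact mul_lt_mul_of_pos_left h4 (by nlinarith)
  have h8 := lt_of_mul_lt_mul_right h7 (by positivity)
  exact lt_of_pow_lt_pow_left₀ 2 hR0.le (by linarith)

theorem exists_isSphereNet (n : ℕ) (r : ℝ) {δ : ℝ} (hδ : 0 < δ) :
    ∃ (m : ℕ) (z : Fin m → Cn n), IsSphereNet r δ z := by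
  obtain ⟨t, hts, htf, hcov⟩ := (isCompact_sphere (0 : Cn n) r).finite_cover_balls hδ
  refine ⟨htf.toFinset.card, fun i => (htf.toFinset.equivFin.symm i : Cn n), fun i => ?_, ?_⟩
  · exact hts (htf.mem_toFinset.1 (htf.toFinset.equivFin.symm i).2)
  · intro x hx
    obtain ⟨y, hy, hxy⟩ := mem_iUnion₂.1 (hcov hx)
    refine mem_iUnion.2 ⟨htf.toFinset.equivFin ⟨y, htf.mem_toFinset.2 hy⟩, ?_⟩
    simpa using hxy

/-- The product of the affine functions defining the hyperplanes. -/
noncomputable def hyperplaneProduct {m : ℕ} (r R : ℝ) (z : Fin m → Cn n) (w : Cn n) : ℂ :=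
  ∏ i, (inner ℂ (z i) w - ((r * R : ℝ) : ℂ))

theorem differentiable_hyperplaneProduct {m : ℕ} (r R : ℝ) (z : Fin m → Cn n) :
    Differentiable ℂ (hyperplaneProduct r R z) := fun w =>
  differentiableAt_finsetProd fun i _ =>
    ((innerSL ℂ (z i)).differentiableAt (x := w)).sub_const _

/-- The normal `z - p` is a nonzero real multiple of `z`, and `⟨z, p⟩ = r R`. -/
theorem mem_hyperplane_dilate_iff {r R : ℝ} (hr : 0 < r) (hrR : r < R) {z : Cn n}
    (hz : z ∈ sphere (0 : Cn n) r) {w : Cn n} :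
    w ∈ hyperplane z (dilate r R z) ↔ inner ℂ z w - ((r * R : ℝ) : ℂ) = 0 := by
  have h1 : ∑ j, starRingEnd ℂ (z j - dilate r R z j) * (w j - dilate r R z j) =
      inner ℂ (z - dilate r R z) (w - dilate r R z) := by
    rw [PiLp.inner_apply]
    refine Finset.sum_congr rfl fun j _ => ?_
    rw [RCLike.inner_apply, mul_comm]
    rfl
  have h2 : z - dilate r R z = ((1 - R / r : ℝ) : ℂ) • z := by
    rw [dilate]
    push_cast
    rw [sub_smul, one_smul]
  have h3 : ((1 - R / r : ℝ) : ℂ) ≠ 0 := by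
    rw [Complex.ofReal_ne_zero, sub_ne_zero]
    exact ((one_lt_div hr).2 hrR).ne
  change ∑ j, _ = _ ↔ _
  rw [h1, h2, inner_smul_left, Complex.conj_ofReal, inner_sub_right, inner_dilate hr hz, mul_eq_zero,
    or_iff_right h3]

theorem ballMinusHyperplanes_eq_slitBall {m : ℕ} {r R : ℝ} (hr : 0 < r) (hrR : r < R)
    {z : Fin m → Cn n} (hz : ∀ i, z i ∈ sphere (0 : Cn n) r) :
    ballMinusHyperplanes r R z = slitBall (hyperplaneProduct r R z) := by
  ext w
  simp [ballMinusHyperplanes, slitBall, mem_unitBall, hyperplaneProduct, Finset.prod_eq_zero_iff,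
    mem_hyperplane_dilate_iff hr hrR (hz _)]

end

end Squeezing

/-! ### Assembly of the theorem. -/

theorem mainTheorem12 (n : ℕ) (hn : 1 ≤ n) (r R : ℝ) (hr : 0 < r) (hrR : r < R) (hR : R < 1) :
    (∃ δ : ℝ, Squeezing.IsAdmissibleRadius n r R δ) ∧
    ∀ δ : ℝ, Squeezing.IsAdmissibleRadius n r R δ →
      (∃ (m : ℕ) (z : Fin m → Squeezing.Cn n), Squeezing.IsSphereNet r δ z) ∧
      ∀ (m : ℕ) (z : Fin m → Squeezing.Cn n), Squeezing.IsSphereNet r δ z →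
        Squeezing.IsPseudoconvexDomain (Squeezing.ballMinusHyperplanes r R z) ∧
        (0 : Squeezing.Cn n) ∈ Squeezing.ballMinusHyperplanes r R z ∧
        Metric.sphere (0 : Squeezing.Cn n) r ⊆ Squeezing.ballMinusHyperplanes r R z ∧
        Squeezing.squeezingFunction (Squeezing.ballMinusHyperplanes r R z) 0 = R ∧
        (∀ w ∈ Metric.sphere (0 : Squeezing.Cn n) r,
          Squeezing.squeezingFunction (Squeezing.ballMinusHyperplanes r R z) w < R) ∧
        ¬ Squeezing.IsPlurisubharmonicOn
            (Squeezing.squeezingFunction (Squeezing.ballMinusHyperplanes r R z))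
            (Squeezing.ballMinusHyperplanes r R z) ∧
        ¬ Squeezing.IsPlurisubharmonicOn
            (Squeezing.fridmanInvariant (Squeezing.ballMinusHyperplanes r R z))
            (Squeezing.ballMinusHyperplanes r R z) := by
  refine ⟨Squeezing.exists_isAdmissibleRadius n hr hrR hR, fun δ hδ =>
    ⟨Squeezing.exists_isSphereNet n r hδ.1, fun m z ⟨hzs, hcov⟩ => ?_⟩⟩
  rw [Squeezing.ballMinusHyperplanes_eq_slitBall hr hrR hzs]
  set L := Squeezing.hyperplaneProduct r R z with hLdef
  have hL : Differentiable ℂ L := Squeezing.differentiable_hyperplaneProduct r R z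
  have hR0 : 0 < R := hr.trans hrR
  have hball : ball 0 R ⊆ Squeezing.slitBall L := by
    intro w hw
    have hwR : ‖w‖ < R := by simpa using hw
    -- By Cauchy–Schwarz, `⟨z_i, w⟩ = r R` forces `‖w‖ ≥ R`.
    refine ⟨hwR.trans hR, Finset.prod_ne_zero_iff.2 fun i _ h => ?_⟩
    have h1 := norm_inner_le_norm (𝕜 := ℂ) (z i) w
    have h2 : ‖z i‖ = r := by simpa using hzs i
    rw [sub_eq_zero.1 h, Complex.norm_real, Real.norm_of_nonneg (by positivity), h2] at h1
    exact hwR.not_ge (le_of_mul_le_mul_left h1 hr)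
  have hsub : sphere (0 : Squeezing.Cn n) r ⊆ Squeezing.slitBall L :=
    (sphere_subset_ball hrR).trans hball
  have h0 : (0 : Squeezing.Cn n) ∈ Squeezing.slitBall L := hball (mem_ball_self hR0)
  have hLp : ∀ i, L (Squeezing.dilate r R (z i)) = 0 := fun i =>
    Finset.prod_eq_zero (Finset.mem_univ i)
      (by rw [Squeezing.inner_dilate hr (hzs i), sub_self])
  have hlt : ∀ w ∈ sphere (0 : Squeezing.Cn n) r, ∃ p : Squeezing.Cn n, ‖p‖ = R ∧ L p = 0 ∧
      ‖Squeezing.ballInvolution w p‖ < R := by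
    intro w hw
    obtain ⟨i, hi⟩ := mem_iUnion.1 (hcov hw)
    have hp := Squeezing.norm_dilate hr hR0 (hzs i)
    have hp1 := hp.trans_lt hR
    refine ⟨Squeezing.dilate r R (z i), hp, hLp i, ?_⟩
    have := (hδ.2 (z i) (hzs i)).2 w hi
    rwa [Squeezing.tanh_caratheodoryDist_unitBall hp1 (hsub hw).1,
      Squeezing.norm_ballInvolution_comm hp1 (hsub hw).1] at this
  obtain ⟨b, hb⟩ : ∃ b : Squeezing.Cn n, ‖b‖ = r := by
    refine ⟨EuclideanSpace.single ⟨0, hn⟩ (r : ℂ), ?_⟩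
    simp [abs_of_pos hr]
  obtain ⟨p, hpR, hp0, -⟩ := hlt b (by simpa using hb)
  have hs0 := Squeezing.squeezingFunction_slitBall_zero hL hR0 hR hball hpR hp0
  have hs : ∀ w ∈ sphere (0 : Squeezing.Cn n) r,
      Squeezing.squeezingFunction (Squeezing.slitBall L) w < R := by
    intro w hw
    obtain ⟨p, hpR, hp0, hpw⟩ := hlt w hw
    exact (Squeezing.squeezingFunction_slitBall_le hL (hsub hw) (hpR.trans_lt hR) hp0).trans_lt hpw
  have he : ∀ w ∈ sphere (0 : Squeezing.Cn n) r,
      Squeezing.fridmanInvariant (Squeezing.slitBall L) w < R := by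
    intro w hw
    obtain ⟨p, hpR, hp0, hpw⟩ := hlt w hw
    exact (Squeezing.fridmanInvariant_slitBall_le hL (hsub hw) (hpR.trans_lt hR) hp0).trans_lt hpw
  have hdisc : ∀ ζ : ℂ, ‖ζ‖ ≤ 1 → ζ • b ∈ Squeezing.slitBall L := by
    intro ζ hζ
    refine hball ?_
    rw [mem_ball, dist_zero_right, norm_smul, hb]
    exact (mul_le_of_le_one_left hr.le hζ).trans_lt hrR
  have hcirc : ∀ ζ : ℂ, ‖ζ‖ = 1 → ζ • b ∈ sphere (0 : Squeezing.Cn n) r := by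
    intro ζ hζ
    rw [mem_sphere, dist_zero_right, norm_smul, hb, hζ, one_mul]
  exact ⟨Squeezing.isPseudoconvexDomain_slitBall hL ⟨0, h0⟩, h0, hsub, hs0, hs,
    Squeezing.not_isPlurisubharmonicOn_of_lt hdisc hs0.ge fun ζ hζ => hs _ (hcirc ζ hζ),
    Squeezing.not_isPlurisubharmonicOn_of_lt hdisc
      (Squeezing.le_fridmanInvariant_slitBall_zero hL hR0 hR hball) fun ζ hζ => he _ (hcirc ζ hζ)⟩
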